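/- Conventions. For a finite simplicial complex $X$ with vertex set $V$, realize each simplex as the corresponding face of the standard simplex in $\mathbb R^V$, with the Euclidean metric (the standard simplexwise metric). A simplexwise smooth $k$-form on $X$ is a family of $k$-forms, one on each closed simplex of $X$ and smooth up to its boundary, such that the form on each face is the pullback of the form on every simplex containing it; $\Omega^k(X)$ is the space of these, and the exterior derivative $d$ is taken simplex by simplex. For a subcomplex $A\subset X$, $\Omega^k(X,A)\subset\Omega^k(X)$ is the subspace of forms whose restriction to every simplex of $A$ is zero. $\|\omega\|_\infty$ is the supremum, over all points of all simplices, of the pointwise comass norm of $\omega$. $\Delta^n$ is the standard $n$-simplex, and $\partial\Delta^n$ is its boundary complex. (1) (First quantitative Poincaré lemma.) For all integers $0<k\le n$ there is a constant $C_{n,k}$ such that the following holds. Let $\omega\in\Omega^k(\Delta^n,\partial\Delta^n)$ be closed and, if $k=n$, suppose in addition that $\int_{\Delta^n}\omega=0$. Then there is $\alpha\in\Omega^{k-1}(\Delta^n,\partial\Delta^n)$ with $d\alpha=\omega$ and $\|\alpha\|_\infty\le C_{n,k}\|\omega\|_\infty$. (2) (Second quantitative Poincaré lemma.) For all integers $0<k\le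 n$ there is a constant $C'_{n,k}$ such that the following holds. Let $\omega\in\Omega^k(\Delta^n)$ be closed and let $\alpha_\partial\in\Omega^{k-1}(\partial\Delta^n)$ satisfy $d\alpha_\partial=\omega|_{\partial\Delta^n}$; if $k=n$, suppose in addition that $\int_{\Delta^n}\omega=\int_{\partial\Delta^n}\alpha_\partial$, where $\partial\Delta^n$ has the boundary orientation. Then there is $\alpha\in\Omega^{k-1}(\Delta^n)$ with $\alpha|_{\partial\Delta^n}=\alpha_\partial$, $d\alpha=\omega$ and $\|\alpha\|_\infty\le C'_{n,k}(\|\omega\|_\infty+\|\alpha_\partial\|_\infty)$. (3) Let $A\subset X$ be a finite simplicial pair. For every $k\ge1$ there is a constant $C(k,X,A)$ such that for every $\omega\in d\,\Omega^{k-1}(X,A)$ there is $\alpha\in\Omega^{k-1}(X,A)$ with $d\alpha=\omega$ and $\|\alpha\|_\infty\le C(k,X,A)\|\omega\|_\infty$. -/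

import Mathlib

open scoped ENNReal NNReal

noncomputable section

namespace SimplicialForms

variable {V : Type*} [Fintype V]

/-- The closed simplex spanned by the vertices `s`: the points of `ℝ^V` with nonnegative
coordinates of sum `1` that are supported in `s`.  The standard simplexwise metric is the
one induced from the Euclidean metric of `ℝ^V`; every simplex is a regular simplex. -/
def closedSimplex (s : Finset V) : Set (EuclideanSpace ℝ V) :=
  {x | (∀ i, 0 ≤ x i) ∧ (∀ i, i ∉ s → x i = 0) ∧ ∑ i, x i = 1}

/-- The tangent space of the simplex spanned by `s`, with the norm induced from the Euclidean
norm of `ℝ^V`. -/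
def simplexDir (s : Finset V) : Submodule ℝ (EuclideanSpace ℝ V) where
  carrier := {v | (∀ i, i ∉ s → v i = 0) ∧ ∑ i, v i = 0}
  add_mem' := by
    rintro a b ⟨ha, ha'⟩ ⟨hb, hb'⟩
    refine ⟨fun i hi => by simp [ha i hi, hb i hi], ?_⟩
    simp [Finset.sum_add_distrib, ha', hb']
  zero_mem' := by simp
  smul_mem' := by
    rintro c a ⟨ha, ha'⟩
    refine ⟨fun i hi => by simp [ha i hi], ?_⟩
    simp [← Finset.mul_sum, ha']

theorem simplexDir_mono {s t : Finset V} (h : s ⊆ t) : simplexDir s ≤ simplexDir t :=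
  fun _ hv => ⟨fun i hi => hv.1 i fun his => hi (h his), hv.2⟩

variable [DecidableEq V]

/-- The vector from the vertex `i` to the vertex `j`, as a tangent vector of a simplex that
contains both. -/
def edgeVec (s : Finset V) (i j : V) (hi : i ∈ s) (hj : j ∈ s) : simplexDir s :=
  ⟨EuclideanSpace.single j 1 - EuclideanSpace.single i 1, by
    refine ⟨fun l hl => ?_, by simp [Finset.sum_sub_distrib]⟩
    have h1 : l ≠ j := fun h => hl (h ▸ hj)
    have h2 : l ≠ i := fun h => hl (h ▸ hi)
    simp [h1, h2]⟩

/-- The barycentre of the simplex spanned by `s`. -/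
def barycenter (s : Finset V) : EuclideanSpace ℝ V :=
  (s.card : ℝ)⁻¹ • ∑ i ∈ s, EuclideanSpace.single i (1 : ℝ)

/-- The isometric parametrization of the affine span of the simplex spanned by `s` by its
tangent space, with the barycentre as origin. -/
def chart (s : Finset V) (v : simplexDir s) : EuclideanSpace ℝ V :=
  barycenter s + (v : EuclideanSpace ℝ V)

/-- The closed simplex read in its chart. -/
def chartDomain (s : Finset V) : Set (simplexDir s) :=
  {v | chart s v ∈ closedSimplex s}

/-- A simplexwise smooth `k`-form on the simplicial complex `K`: a form on every closed
simplex, smooth up to the boundary, such that the form on a face is the pullback (restriction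
to tangent vectors of the face) of the form on the simplex.  Only the values `toFun s x` with
`s` a simplex of `K` and `x` a point of that simplex are meaningful. -/
structure SimplexwiseForm (K : PreAbstractSimplicialComplex V) (k : ℕ) where
  toFun : (s : Finset V) → EuclideanSpace ℝ V → simplexDir s [⋀^Fin k]→L[ℝ] ℝ
  smooth : ∀ s ∈ K.faces, ContDiffOn ℝ ((⊤ : ℕ∞) : WithTop ℕ∞)
    (fun v => toFun s (chart s v)) (chartDomain s)
  compatible : ∀ s ∈ K.faces, ∀ t ∈ K.faces, ∀ h : s ⊆ t, ∀ x ∈ closedSimplex s,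
    ∀ w : Fin k → simplexDir s,
      toFun t x (fun j => Submodule.inclusion (simplexDir_mono h) (w j)) = toFun s x w

namespace SimplexwiseForm

variable {K A : PreAbstractSimplicialComplex V} {k : ℕ}

/-- The exterior derivative of the form on the simplex `s`, at the point `chart s v`. -/
def dAt (ω : SimplexwiseForm K k) (s : Finset V) (v : simplexDir s) :
    simplexDir s [⋀^Fin (k + 1)]→L[ℝ] ℝ :=
  extDerivWithin (fun v => ω.toFun s (chart s v)) (chartDomain s) v

/-- `dα = ω`. -/
def IsPrimitiveOf (α : SimplexwiseForm K k) (ω : SimplexwiseForm K (k + 1)) : Prop :=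
  ∀ s ∈ K.faces, ∀ v ∈ chartDomain s, α.dAt s v = ω.toFun s (chart s v)

/-- `dω = 0`. -/
def IsClosedForm (ω : SimplexwiseForm K k) : Prop :=
  ∀ s ∈ K.faces, ∀ v ∈ chartDomain s, ω.dAt s v = 0

/-- The restriction of a form to a subcomplex. -/
def restrict (ω : SimplexwiseForm K k) (h : A ≤ K) : SimplexwiseForm A k where
  toFun := ω.toFun
  smooth s hs := ω.smooth s (h hs)
  compatible s hs t ht := ω.compatible s (h hs) t (h ht)

/-- Equality of two forms: they agree at all points of all simplices of the complex. -/
def Agrees (ω η : SimplexwiseForm K k) : Prop :=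
  ∀ s ∈ K.faces, ∀ x ∈ closedSimplex s, ω.toFun s x = η.toFun s x

/-- The form is zero at all points of all simplices of the complex. -/
def IsZero (ω : SimplexwiseForm K k) : Prop :=
  ∀ s ∈ K.faces, ∀ x ∈ closedSimplex s, ω.toFun s x = 0

/-- The `L^∞` norm: the supremum, over the points of all simplices, of the comass
`sup |ω_x(v₁, …, v_k)|` over tangent vectors of Euclidean length at most `1`. -/
def supNorm (ω : SimplexwiseForm K k) : ℝ≥0∞ :=
  ⨆ s ∈ K.faces, ⨆ x ∈ closedSimplex s, ‖ω.toFun s x‖ₑ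

/-- The integral of a `k`-form over the `k`-simplex spanned by `s`, oriented by the order
`p 0 < ⋯ < p k` of its vertices: the integral, over the points `y` of `ℝ^k` with `0 ≤ y j` and
`∑ y j ≤ 1`, of the pullback under `y ↦ p 0 + ∑ j, y j (p (j + 1) - p 0)`. -/
def integral [LinearOrder V] (ω : SimplexwiseForm K k) (s : Finset V) (hs : s.card = k + 1) : ℝ :=
  let u : Fin k → simplexDir s := fun j =>
    edgeVec s (s.orderEmbOfFin hs 0) (s.orderEmbOfFin hs j.succ)
      (s.orderEmbOfFin_mem hs 0) (s.orderEmbOfFin_mem hs j.succ)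
  ∫ y in {y : Fin k → ℝ | (∀ j, 0 ≤ y j) ∧ ∑ j, y j ≤ 1},
    ω.toFun s (EuclideanSpace.single (s.orderEmbOfFin hs 0) 1 + ∑ j, y j • (u j).val) u

end SimplexwiseForm

/-- The standard `n`-simplex as a simplicial complex: all nonempty sets of its `n + 1`
vertices. -/
def stdComplex (n : ℕ) : PreAbstractSimplicialComplex (Fin (n + 1)) := ⊤

/-- The boundary of the standard `n`-simplex: all proper faces. -/
def bdryComplex (n : ℕ) : PreAbstractSimplicialComplex (Fin (n + 1)) where
  faces := {s | s.Nonempty ∧ s ≠ Finset.univ}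
  isRelLowerSet_faces := by
    rintro s ⟨hs, hs'⟩
    refine ⟨hs, fun t hts ht => ⟨ht, fun h => hs' ?_⟩⟩
    exact Finset.univ_subset_iff.1 (h ▸ hts)

theorem bdryComplex_le (n : ℕ) : bdryComplex n ≤ stdComplex n := fun _ hs => hs.1

/-- The integral over the standard `n`-simplex of an `n`-form. -/
def stdIntegral {n k : ℕ} (ω : SimplexwiseForm (stdComplex n) k) (h : k = n) : ℝ :=
  ω.integral Finset.univ (by simp [h])

/-- The integral over the boundary of the standard `n`-simplex of an `(n - 1)`-form, with the
boundary orientation. -/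
def bdryIntegral {n k : ℕ} (α : SimplexwiseForm (bdryComplex n) k) (h : k + 1 = n) : ℝ :=
  ∑ i : Fin (n + 1), (-1 : ℝ) ^ (i : ℕ) * α.integral (Finset.univ.erase i) (by simp [h])

end SimplicialForms

end

open SimplicialForms

/-! The engine is the cone operator `h` with apex `p`: average a form along the segments from `p`
with a suitable power of the parameter and contract with the radial vector. It satisfies `dh + hd =
id` in positive degree (`extDerivWithin_coneForm`), keeps smoothness up to the boundary of a compact
convex set, and is bounded in sup norm by the diameter. If `p` lies in a face, the segments from `p`
to that face stay in it, so `h` commutes with restriction to it (`faceRes_coneOp`).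

The relative Poincaré lemma (`exists_relative_primitive`) goes by induction on the dimension. Cone a
closed form `f` vanishing on the boundary from a vertex `q`: `c = h f` is a primitive of `f` and
vanishes on every facet through `q`. On the opposite facet `F` it is closed, vanishes on the
boundary of `F`, and in top degree has integral `± ∫ f = 0` (`simplexIntegral_eq_coneOp`). If `c` is
a function, its restriction to `F` is therefore zero. Otherwise induction writes this restriction as
`dγ` with `γ` vanishing on the boundary of `F`. Radial projection from `q`, damped by a cutoff near
`q`, extends `γ` to a form `extOp q γ` vanishing on the other facets, and `c - d(extOp q γ)` is the
primitive sought. The estimates close because the bound for `d(extOp q γ)` involves only `γ` and `dγ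
= c|F`, both controlled by `f`.

For prescribed boundary values, extend them facet by facet to a form `e`
(`exists_partial_extension`) and apply the relative lemma to `f - de`; Stokes' theorem
(`simplexIntegral_extD`) supplies the integral condition. The first lemma of the statement is then
the second with zero boundary values.

For a pair `(X, A)`, exactness of `ω` enters only through its integrals over the `(k +
1)`-simplices. These periods span a finite-dimensional space, so a linear section of the period map
yields a relative form `c` with `dc` of the same periods and with `c`, `dc` bounded by `ω`
(`exists_bounded_period_correction`). Now `ω - dc` integrates to zero over every `(k + 1)`-simplex,
so a primitive can be started as zero on `A` and on the `k`-skeleton and extended over the remaining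
simplices in order of dimension (`exists_skeletalPrimitive`). -/

set_option linter.unusedSectionVars false

noncomputable section

namespace SimplicialForms

open scoped ContDiff Topology
open Set

universe u

/-! ### Radial averages and the cone operator on convex sets -/

section Analysis

variable {E F G : Type u} [NormedAddCommGroup E] [NormedSpace ℝ E] [NormedAddCommGroup F]
  [NormedSpace ℝ F] [NormedAddCommGroup G] [NormedSpace ℝ G]

/-- The weighted average `∫₀¹ tᵐ f(p + t (x - p)) dt` of `f` over the segment from `p` to `x`. -/
def coneAverage {G : Type*} [NormedAddCommGroup G] [NormedSpace ℝ G] (m : ℕ) (p : E) (f : E → G)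
    (x : E) : G :=
  ∫ t in (0 : ℝ)..1, t ^ m • f (AffineMap.lineMap p x t)

variable {D : Set E} {p x : E} {f : E → G}

theorem continuousOn_coneAverage_integrand (hD : Convex ℝ D) (hp : p ∈ D) (hx : x ∈ D)
    (hf : ContinuousOn f D) (m : ℕ) :
    ContinuousOn (fun t : ℝ => t ^ m • f (AffineMap.lineMap p x t)) (Icc 0 1) := by
  refine (continuous_pow m).continuousOn.smul (hf.comp (Continuous.continuousOn ?_) ?_)
  · exact AffineMap.lineMap_continuous
  · exact fun t ht => hD.lineMap_mem hp hx ht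

theorem intervalIntegrable_coneAverage (hD : Convex ℝ D) (hp : p ∈ D) (hx : x ∈ D)
    (hf : ContinuousOn f D) (m : ℕ) :
    IntervalIntegrable (fun t : ℝ => t ^ m • f (AffineMap.lineMap p x t))
      MeasureTheory.volume 0 1 := by
  apply ContinuousOn.intervalIntegrable
  rw [uIcc_of_le zero_le_one]
  exact continuousOn_coneAverage_integrand hD hp hx hf m

theorem coneAverage_congr (hD : Convex ℝ D) (hp : p ∈ D) (hx : x ∈ D) {g : E → G}
    (h : EqOn f g D) (m : ℕ) : coneAverage m p f x = coneAverage m p g x := by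
  refine intervalIntegral.integral_congr fun t ht => ?_
  rw [uIcc_of_le zero_le_one] at ht
  simp only [h (hD.lineMap_mem hp hx ht)]

theorem norm_coneAverage_le (hD : Convex ℝ D) (hp : p ∈ D) (hx : x ∈ D) {M : ℝ}
    (h : ∀ y ∈ D, ‖f y‖ ≤ M) (m : ℕ) : ‖coneAverage m p f x‖ ≤ M := by
  have h1 := intervalIntegral.norm_integral_le_of_norm_le_const (a := (0 : ℝ)) (b := 1) (C := M)
    (f := fun t : ℝ => t ^ m • f (AffineMap.lineMap p x t)) ?_
  · simpa [coneAverage] using h1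
  · intro t ht
    rw [uIoc_of_le zero_le_one] at ht
    have h2 := h _ (hD.lineMap_mem hp hx ⟨ht.1.le, ht.2⟩)
    rw [norm_smul, norm_pow, Real.norm_of_nonneg ht.1.le]
    calc t ^ m * ‖f (AffineMap.lineMap p x t)‖ ≤ 1 * M :=
          mul_le_mul (pow_le_one₀ ht.1.le ht.2) h2 (norm_nonneg _) zero_le_one
      _ = M := one_mul M

theorem map_coneAverage {F : Type*} [NormedAddCommGroup F] [NormedSpace ℝ F]
    [CompleteSpace G] [CompleteSpace F] (hD : Convex ℝ D) (hp : p ∈ D)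
    (hx : x ∈ D) (hf : ContinuousOn f D) (m : ℕ) (L : G →L[ℝ] F) :
    L (coneAverage m p f x) = coneAverage m p (fun y => L (f y)) x := by
  rw [coneAverage, ← L.intervalIntegral_comp_comm (intervalIntegrable_coneAverage hD hp hx hf m)]
  simp [coneAverage]

/-- The map `x ↦ p + t (x - p)` has derivative `t`, which raises the exponent by one. The remainder
is small uniformly in `t` because `f'` is uniformly continuous on the compact set and the mean value
inequality applies on the intersection of `D` with a small ball. -/
theorem hasFDerivWithinAt_coneAverage [CompleteSpace G] (hD : Convex ℝ D) (hc : IsCompact D)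
    (hp : p ∈ D) (hx : x ∈ D) {f' : E → E →L[ℝ] G}
    (hf : ∀ y ∈ D, HasFDerivWithinAt f (f' y) D y) (hf' : ContinuousOn f' D) (m : ℕ) :
    HasFDerivWithinAt (coneAverage m p f) (coneAverage (m + 1) p f' x) D x := by
  have hfc : ContinuousOn f D := fun y hy => (hf y hy).continuousWithinAt
  rw [hasFDerivWithinAt_iff_isLittleO, Asymptotics.isLittleO_iff]
  intro ε hε
  have huc := hc.uniformContinuousOn_of_continuous hf'
  rw [Metric.uniformContinuousOn_iff_le] at huc
  obtain ⟨δ, hδ, huc⟩ := huc ε hε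
  have hnhds : D ∩ Metric.ball x δ ∈ 𝓝[D] x :=
    Filter.inter_mem self_mem_nhdsWithin (mem_nhdsWithin_of_mem_nhds (Metric.ball_mem_nhds x hδ))
  filter_upwards [hnhds] with y ⟨hy, hyx⟩
  have hdist (t : ℝ) : (AffineMap.lineMap p y t : E) - AffineMap.lineMap p x t = t • (y - x) := by
    simp [AffineMap.lineMap_apply, ← smul_sub]
  have hap : coneAverage (m + 1) p f' x (y - x) =
      ∫ t in (0 : ℝ)..1, t ^ m • f' (AffineMap.lineMap p x t) (t • (y - x)) := by
    rw [coneAverage, ContinuousLinearMap.intervalIntegral_apply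
      (intervalIntegrable_coneAverage hD hp hx hf' (m + 1))]
    congr 1
    ext t
    simp [pow_succ, mul_smul]
  have hint : IntervalIntegrable
      (fun t : ℝ => t ^ m • f' (AffineMap.lineMap p x t) (t • (y - x)))
      MeasureTheory.volume 0 1 := by
    apply ContinuousOn.intervalIntegrable
    rw [uIcc_of_le zero_le_one]
    refine (continuous_pow m).continuousOn.smul (ContinuousOn.clm_apply
      (hf'.comp (AffineMap.lineMap_continuous.continuousOn)
        fun t ht => hD.lineMap_mem hp hx ht) ?_)
    fun_prop
  rw [hap, coneAverage, coneAverage, ← intervalIntegral.integral_sub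
    (intervalIntegrable_coneAverage hD hp hy hfc m)
    (intervalIntegrable_coneAverage hD hp hx hfc m),
    ← intervalIntegral.integral_sub ((intervalIntegrable_coneAverage hD hp hy hfc m).sub
    (intervalIntegrable_coneAverage hD hp hx hfc m)) hint]
  have h1 := intervalIntegral.norm_integral_le_of_norm_le_const (a := (0 : ℝ)) (b := 1)
    (C := ε * ‖y - x‖)
    (f := fun t : ℝ => t ^ m • f (AffineMap.lineMap p y t) - t ^ m • f (AffineMap.lineMap p x t)
      - t ^ m • f' (AffineMap.lineMap p x t) (t • (y - x))) ?_
  · simpa using h1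
  · intro t ht
    rw [uIoc_of_le zero_le_one] at ht
    have htI : t ∈ Icc (0 : ℝ) 1 := ⟨ht.1.le, ht.2⟩
    have hxt := hD.lineMap_mem hp hx htI
    have hyt := hD.lineMap_mem hp hy htI
    have hle : ‖t • (y - x)‖ ≤ ‖y - x‖ := by
      rw [norm_smul, Real.norm_of_nonneg ht.1.le]
      exact mul_le_of_le_one_left (norm_nonneg _) ht.2
    have key : ‖f (AffineMap.lineMap p y t) - f (AffineMap.lineMap p x t) -
        f' (AffineMap.lineMap p x t) (AffineMap.lineMap p y t - AffineMap.lineMap p x t)‖ ≤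
        ε * ‖(AffineMap.lineMap p y t : E) - AffineMap.lineMap p x t‖ := by
      refine Convex.norm_image_sub_le_of_norm_hasFDerivWithin_le' (f' := f')
        (s := D ∩ Metric.closedBall (AffineMap.lineMap p x t) δ)
        (fun z hz => (hf z hz.1).mono inter_subset_left) ?_
        (hD.inter (convex_closedBall _ _)) ⟨hxt, Metric.mem_closedBall_self hδ.le⟩
        ⟨hyt, ?_⟩
      · intro z hz
        rw [← dist_eq_norm]
        exact huc z hz.1 _ hxt hz.2
      · rw [Metric.mem_closedBall, dist_eq_norm, hdist]
        rw [Metric.mem_ball, dist_eq_norm] at hyx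
        exact hle.trans hyx.le
    rw [hdist] at key
    rw [← smul_sub, ← smul_sub, norm_smul, norm_pow, Real.norm_of_nonneg ht.1.le]
    calc t ^ m * _ ≤ 1 * (ε * ‖t • (y - x)‖) :=
          mul_le_mul (pow_le_one₀ ht.1.le ht.2) key (norm_nonneg _) zero_le_one
      _ ≤ ε * ‖y - x‖ := by rw [one_mul]; gcongr

/-- The derivative of an average is an average of the derivative, with a larger weight and with
values in `E →L[ℝ] G`. Hence the induction on the order of smoothness must quantify over the target
space and over `m`. -/
theorem contDiffOn_nat_coneAverage (hD : Convex ℝ D) (hc : IsCompact D) (hu : UniqueDiffOn ℝ D)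
    (hp : p ∈ D) (n : ℕ) : ∀ {G : Type u} [NormedAddCommGroup G] [NormedSpace ℝ G]
    [CompleteSpace G] {f : E → G} (_ : ContDiffOn ℝ ∞ f D) (m : ℕ),
    ContDiffOn ℝ n (coneAverage m p f) D := by
  induction n with
  | zero =>
    intro G _ _ _ f hf m
    have hf1 := (contDiffOn_infty_iff_fderivWithin hu).1 hf
    refine contDiffOn_zero.2 fun x hx => ?_
    exact (hasFDerivWithinAt_coneAverage hD hc hp hx
      (fun y hy => (hf1.1 y hy).hasFDerivWithinAt) hf1.2.continuousOn m).continuousWithinAt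
  | succ n ih =>
    intro G _ _ _ f hf m
    have hf1 := (contDiffOn_infty_iff_fderivWithin hu).1 hf
    have hd : ∀ x ∈ D, HasFDerivWithinAt (coneAverage m p f)
        (coneAverage (m + 1) p (fderivWithin ℝ f D) x) D x := fun x hx =>
      hasFDerivWithinAt_coneAverage hD hc hp hx
        (fun y hy => (hf1.1 y hy).hasFDerivWithinAt) hf1.2.continuousOn m
    push_cast
    rw [contDiffOn_succ_iff_fderivWithin hu]
    refine ⟨fun x hx => (hd x hx).differentiableWithinAt, by simp, ?_⟩
    exact (ih hf1.2 (m + 1)).congr fun x hx => (hd x hx).fderivWithin (hu x hx)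

theorem contDiffOn_coneAverage [CompleteSpace G] (hD : Convex ℝ D) (hc : IsCompact D)
    (hu : UniqueDiffOn ℝ D) (hp : p ∈ D) (hf : ContDiffOn ℝ ∞ f D) (m : ℕ) :
    ContDiffOn ℝ ∞ (coneAverage m p f) D :=
  contDiffOn_infty.2 fun n => contDiffOn_nat_coneAverage hD hc hu hp n hf m

/-- The radial derivative along the segment from `p` to `x`. -/
theorem hasDerivWithinAt_comp_lineMap (hD : Convex ℝ D) (hp : p ∈ D) (hx : x ∈ D)
    (hf : DifferentiableOn ℝ f D) {t : ℝ} (ht : t ∈ Icc (0 : ℝ) 1) :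
    HasDerivWithinAt (fun t : ℝ => f (AffineMap.lineMap p x t))
      (fderivWithin ℝ f D (AffineMap.lineMap p x t) (x - p)) (Icc 0 1) t := by
  have h1 := (hf _ (hD.lineMap_mem hp hx ht)).hasFDerivWithinAt
  exact h1.comp_hasDerivWithinAt t (AffineMap.hasDerivWithinAt_lineMap)
    (fun s hs => hD.lineMap_mem hp hx hs)

/-- The fundamental theorem of calculus for `t ^ (m + 1) • f (p + t (x - p))`; the positive power
kills the endpoint `t = 0`. -/
theorem coneAverage_fderivWithin_apply [CompleteSpace G] (hD : Convex ℝ D)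
    (hu : UniqueDiffOn ℝ D) (hp : p ∈ D) (hx : x ∈ D) (hf : ContDiffOn ℝ ∞ f D) (m : ℕ) :
    coneAverage (m + 1) p (fderivWithin ℝ f D) x (x - p) +
      (m + 1 : ℝ) • coneAverage m p f x = f x := by
  have hf1 := (contDiffOn_infty_iff_fderivWithin hu).1 hf
  have h1 := intervalIntegrable_coneAverage hD hp hx hf1.2.continuousOn (m + 1)
  have h2 := intervalIntegrable_coneAverage hD hp hx hf.continuousOn m
  have h3 : IntervalIntegrable (fun t : ℝ => t ^ (m + 1) •
      fderivWithin ℝ f D (AffineMap.lineMap p x t) (x - p)) MeasureTheory.volume 0 1 :=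
    intervalIntegrable_coneAverage (f := fun y => fderivWithin ℝ f D y (x - p)) hD hp hx
      (hf1.2.continuousOn.clm_apply continuousOn_const) (m + 1)
  rw [coneAverage, ContinuousLinearMap.intervalIntegral_apply h1, coneAverage,
    ← intervalIntegral.integral_smul]
  change (∫ t in (0 : ℝ)..1, t ^ (m + 1) • fderivWithin ℝ f D (AffineMap.lineMap p x t) (x - p)) +
    (∫ t in (0 : ℝ)..1, ((m + 1 : ℝ) • fun t : ℝ => t ^ m • f (AffineMap.lineMap p x t)) t) = f x
  rw [← intervalIntegral.integral_add h3 (h2.smul _)]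
  have hder : ∀ t ∈ Ioo (0 : ℝ) 1, HasDerivAt
      (fun t : ℝ => t ^ (m + 1) • f (AffineMap.lineMap p x t))
      (t ^ (m + 1) • fderivWithin ℝ f D (AffineMap.lineMap p x t) (x - p) +
        (m + 1 : ℝ) • t ^ m • f (AffineMap.lineMap p x t)) t := by
    intro t ht
    have h5 := (hasDerivWithinAt_comp_lineMap hD hp hx hf1.1 (Ioo_subset_Icc_self ht)).hasDerivAt
      (Icc_mem_nhds ht.1 ht.2)
    have h6 := (hasDerivAt_pow (m + 1) t).smul h5
    simp only [Nat.cast_add, Nat.cast_one, Nat.add_sub_cancel, mul_smul] at h6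
    exact h6
  have h7 := intervalIntegral.integral_eq_sub_of_hasDerivAt_of_le zero_le_one
    (continuousOn_coneAverage_integrand hD hp hx hf.continuousOn (m + 1)) hder
    (h3.add (h2.smul _))
  simpa using h7

/-- Without a weight the endpoint `t = 0` survives. This is the source of the evaluation term in the
homotopy formula for functions. -/
theorem coneAverage_zero_fderivWithin_apply [CompleteSpace G] (hD : Convex ℝ D)
    (hu : UniqueDiffOn ℝ D) (hp : p ∈ D) (hx : x ∈ D) (hf : ContDiffOn ℝ ∞ f D) :
    coneAverage 0 p (fderivWithin ℝ f D) x (x - p) = f x - f p := by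
  have hf1 := (contDiffOn_infty_iff_fderivWithin hu).1 hf
  have h1 := intervalIntegrable_coneAverage hD hp hx hf1.2.continuousOn 0
  rw [coneAverage, ContinuousLinearMap.intervalIntegral_apply h1]
  have h7 := intervalIntegral.integral_eq_sub_of_hasDerivAt_of_le zero_le_one
    (f := fun t : ℝ => f (AffineMap.lineMap p x t))
    (f' := fun t : ℝ => fderivWithin ℝ f D (AffineMap.lineMap p x t) (x - p))
    (by simpa using continuousOn_coneAverage_integrand hD hp hx hf.continuousOn 0)
    (fun t ht => (hasDerivWithinAt_comp_lineMap hD hp hx hf1.1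
      (Ioo_subset_Icc_self ht)).hasDerivAt (Icc_mem_nhds ht.1 ht.2))
    (by
      have h2 := intervalIntegrable_coneAverage (f := fun y => fderivWithin ℝ f D y (x - p))
        hD hp hx (hf1.2.continuousOn.clm_apply continuousOn_const) 0
      simpa only [pow_zero, one_smul] using h2)
  simpa using h7

theorem hasFDerivWithinAt_apply_sub (C : F →L[ℝ] E →L[ℝ] G) (p : E) {h : E → F}
    {h' : E →L[ℝ] F} (hh : HasFDerivWithinAt h h' D x) :
    HasFDerivWithinAt (fun y => C (h y) (y - p))
      (((ContinuousLinearMap.apply ℝ G (x - p)).comp C).comp h' + C (h x)) D x := by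
  have h1 := ((C.hasFDerivAt (x := h x)).comp_hasFDerivWithinAt x hh).clm_apply
    ((hasFDerivWithinAt_id x D).sub_const p)
  refine h1.congr_fderiv ?_
  ext e
  simp [add_comm]

open ContinuousAlternatingMap

/-- Currying the first argument of a form, as a continuous linear map. -/
def curryCLM (E : Type u) [NormedAddCommGroup E] [NormedSpace ℝ E] (n : ℕ) :
    (E [⋀^Fin (n + 1)]→L[ℝ] ℝ) →L[ℝ] E →L[ℝ] (E [⋀^Fin n]→L[ℝ] ℝ) :=
  (curryLeftLI (𝕜 := ℝ) (E := E) (F := ℝ) (n := n)).toContinuousLinearMap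

theorem contDiff_curryCLM (n : ℕ) :
    ContDiff ℝ ∞ (curryCLM E n) := by
  apply ContinuousLinearMap.contDiff

theorem contDiff_alternatizeUncurryFinCLM (n : ℕ) :
    ContDiff ℝ ∞ (alternatizeUncurryFinCLM (n := n) ℝ E ℝ) := by
  apply ContinuousLinearMap.contDiff

theorem contDiff_compContinuousLinearMapCLM (n : ℕ) (L : E →L[ℝ] F) :
    ContDiff ℝ ∞ (compContinuousLinearMapCLM L :
      (F [⋀^Fin n]→L[ℝ] ℝ) →L[ℝ] (E [⋀^Fin n]→L[ℝ] ℝ)) := by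
  apply ContinuousLinearMap.contDiff

/-- Contraction with a fixed vector, as a continuous linear map on forms. -/
def contractCLM (n : ℕ) (X : E) : (E [⋀^Fin (n + 1)]→L[ℝ] ℝ) →L[ℝ] (E [⋀^Fin n]→L[ℝ] ℝ) :=
  (ContinuousLinearMap.apply ℝ _ X).comp (curryCLM E n)

theorem contractCLM_apply {n : ℕ} (X : E) (g : E [⋀^Fin (n + 1)]→L[ℝ] ℝ) :
    contractCLM n X g = g.curryLeft X := rfl

/-- The algebraic form of Cartan's formula. -/
theorem alternatizeUncurryFin_contract_add {n : ℕ} (B : E →L[ℝ] E [⋀^Fin (n + 1)]→L[ℝ] ℝ)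
    (X : E) : alternatizeUncurryFin ((contractCLM n X).comp B) +
      (alternatizeUncurryFin B).curryLeft X = B X := by
  ext w
  simp only [ContinuousAlternatingMap.add_apply, curryLeft_apply_apply,
    alternatizeUncurryFin_apply, ContinuousLinearMap.comp_apply, contractCLM_apply]
  -- The term with `X` in the slot being differentiated is `B X w`; the others cancel against the
  -- alternation of the contraction.
  rw [Fin.sum_univ_succ (n := n + 1)]
  have h : ∀ i : Fin (n + 1), (-1 : ℤ) ^ (i.succ : ℕ) •
      B (Matrix.vecCons X w i.succ) (i.succ.removeNth (Matrix.vecCons X w)) =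
      - ((-1 : ℤ) ^ (i : ℕ) • B (w i) (Matrix.vecCons X (i.removeNth w))) := by
    intro i
    have h1 : i.succ.removeNth (Matrix.vecCons X w) = Matrix.vecCons X (i.removeNth w) := by
      ext j
      refine Fin.cases ?_ (fun j => ?_) j
      · simp [Fin.removeNth]
      · simp [Fin.removeNth]
    rw [h1]
    simp [pow_succ]
  have h0 : (0 : Fin (n + 2)).removeNth (Matrix.vecCons X w) = w := by
    ext j
    simp [Fin.removeNth]
  rw [Finset.sum_congr rfl fun i _ => h i, h0]
  simp

/-- The cone operator on forms, with apex `p`. -/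
def coneForm {m : ℕ} (p : E) (f : E → E [⋀^Fin (m + 1)]→L[ℝ] ℝ) (x : E) : E [⋀^Fin m]→L[ℝ] ℝ :=
  (coneAverage m p f x).curryLeft (x - p)

section ConeForm

variable {m : ℕ} {f : E → E [⋀^Fin (m + 1)]→L[ℝ] ℝ}

theorem contDiffOn_coneForm (hD : Convex ℝ D) (hc : IsCompact D)
    (hu : UniqueDiffOn ℝ D) (hp : p ∈ D) (hf : ContDiffOn ℝ ∞ f D) :
    ContDiffOn ℝ ∞ (coneForm p f) D := by
  have h1 := contDiffOn_coneAverage hD hc hu hp hf m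
  have h2 : ContDiffOn ℝ ∞ (fun x => curryCLM E m (coneAverage m p f x)) D :=
    (contDiff_curryCLM m).comp_contDiffOn h1
  exact h2.clm_apply (contDiffOn_id.sub contDiffOn_const)

theorem norm_coneForm_le (hD : Convex ℝ D) (hp : p ∈ D) (hx : x ∈ D) {M : ℝ}
    (h : ∀ y ∈ D, ‖f y‖ ≤ M) : ‖coneForm p f x‖ ≤ M * ‖x - p‖ := by
  refine ((coneAverage m p f x).curryLeft.le_opNorm (x - p)).trans ?_
  rw [norm_curryLeft]
  gcongr
  exact norm_coneAverage_le hD hp hx h m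

/-- Differentiating the cone form gives two terms. The one where the average `B` of the derivative
is contracted combines, by Cartan's formula, with the cone of `df` to `B (x - p)`. The one where the
radial vector is differentiated alternates to `m + 1` times the average of `f`. Their sum is `f x`
by the radial identity. -/
theorem extDerivWithin_coneForm (hD : Convex ℝ D) (hc : IsCompact D)
    (hu : UniqueDiffOn ℝ D) (hp : p ∈ D) (hx : x ∈ D) (hf : ContDiffOn ℝ ∞ f D) :
    extDerivWithin (coneForm p f) D x + coneForm p (extDerivWithin f D) x = f x := by
  have hf1 := (contDiffOn_infty_iff_fderivWithin hu).1 hf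
  set g := coneAverage m p f x with hg
  set B := coneAverage (m + 1) p (fderivWithin ℝ f D) x with hB
  have hdg : HasFDerivWithinAt (coneAverage m p f) B D x :=
    hasFDerivWithinAt_coneAverage hD hc hp hx (fun y hy => (hf1.1 y hy).hasFDerivWithinAt)
      hf1.2.continuousOn m
  have hder : HasFDerivWithinAt (coneForm p f) ((contractCLM m (x - p)).comp B + g.curryLeft)
      D x := by
    have h3 := hasFDerivWithinAt_apply_sub (curryCLM E m) p hdg
    exact h3
  have h4 : coneAverage (m + 1) p (extDerivWithin f D) x = alternatizeUncurryFin B := by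
    exact (map_coneAverage hD hp hx hf1.2.continuousOn (m + 1)
      (alternatizeUncurryFinCLM ℝ E ℝ)).symm
  rw [extDerivWithin, hder.fderivWithin (hu x hx), coneForm, h4, alternatizeUncurryFin_add,
    alternatizeUncurryFin_curryLeft, add_right_comm, alternatizeUncurryFin_contract_add,
    ← coneAverage_fderivWithin_apply hD hu hp hx hf m, ← Nat.cast_smul_eq_nsmul ℝ]
  push_cast
  rfl

end ConeForm

theorem coneForm_extDerivWithin_zero {f : E → E [⋀^Fin 0]→L[ℝ] ℝ} (hD : Convex ℝ D)
    (hu : UniqueDiffOn ℝ D) (hp : p ∈ D) (hx : x ∈ D) (hf : ContDiffOn ℝ ∞ f D) :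
    coneForm p (extDerivWithin f D) x = f x - f p := by
  have hf1 := (contDiffOn_infty_iff_fderivWithin hu).1 hf
  have h4 : coneAverage 0 p (extDerivWithin f D) x =
      alternatizeUncurryFin (coneAverage 0 p (fderivWithin ℝ f D) x) :=
    (map_coneAverage hD hp hx hf1.2.continuousOn 0 (alternatizeUncurryFinCLM ℝ E ℝ)).symm
  rw [coneForm, h4, ← coneAverage_zero_fderivWithin_apply hD hu hp hx hf]
  ext w
  simp [alternatizeUncurryFin_apply]

/-- Joint smoothness in the form and the linear map is needed because the derivative of the radial
projection varies with the point. Currying one argument reduces to degree `k`, and alternating a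
curried form returns `k + 1` times the form, whence the factor `((k : ℝ) + 1)⁻¹`. -/
theorem contDiff_compContinuousLinearMap [FiniteDimensional ℝ E] [FiniteDimensional ℝ F] (k : ℕ) :
    ContDiff ℝ ∞ fun q : (F [⋀^Fin k]→L[ℝ] ℝ) × (E →L[ℝ] F) =>
      q.1.compContinuousLinearMap q.2 := by
  induction k with
  | zero =>
    have h : (fun q : (F [⋀^Fin 0]→L[ℝ] ℝ) × (E →L[ℝ] F) => q.1.compContinuousLinearMap q.2) =
        fun q => compContinuousLinearMapCLM (0 : E →L[ℝ] F) q.1 := by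
      ext q w
      simp only [compContinuousLinearMap_apply, compContinuousLinearMapCLM_apply]
      congr 1
      exact Subsingleton.elim _ _
    rw [h]
    exact (contDiff_compContinuousLinearMapCLM 0 0).comp contDiff_fst
  | succ k ih =>
    let T : (F [⋀^Fin (k + 1)]→L[ℝ] ℝ) × (E →L[ℝ] F) → E →L[ℝ] (E [⋀^Fin k]→L[ℝ] ℝ) :=
      fun q => ((compContinuousLinearMapCLM q.2).comp q.1.curryLeft).comp q.2
    have hT : ContDiff ℝ ∞ T := by
      rw [contDiff_clm_apply_iff]
      intro e
      refine ih.comp (ContDiff.prodMk ?_ contDiff_snd)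
      exact ((contDiff_curryCLM k).comp contDiff_fst).clm_apply
        (contDiff_snd.clm_apply contDiff_const)
    have h : (fun q : (F [⋀^Fin (k + 1)]→L[ℝ] ℝ) × (E →L[ℝ] F) =>
        q.1.compContinuousLinearMap q.2) =
        fun q => ((k : ℝ) + 1)⁻¹ • alternatizeUncurryFinCLM ℝ E ℝ (T q) := by
      ext1 q
      have h1 : T q = (q.1.compContinuousLinearMap q.2).curryLeft := by
        ext e w
        simp only [T, ContinuousLinearMap.comp_apply, compContinuousLinearMapCLM_apply,
          compContinuousLinearMap_apply, curryLeft_apply_apply]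
        congr 1
        ext j
        refine Fin.cases ?_ (fun j => ?_) j <;> simp
      rw [h1, alternatizeUncurryFinCLM_apply, alternatizeUncurryFin_curryLeft,
        ← Nat.cast_smul_eq_nsmul ℝ, smul_smul]
      push_cast
      rw [inv_mul_cancel₀ (by positivity), one_smul]
    rw [h]
    refine ContDiff.smul (f := fun _ => ((k : ℝ) + 1)⁻¹) contDiff_const ?_
    exact (contDiff_alternatizeUncurryFinCLM k).comp hT

theorem contDiffOn_const_smul (c : ℝ) (hf : ContDiffOn ℝ ∞ f D) :
    ContDiffOn ℝ ∞ (fun y => c • f y) D :=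
  contDiffOn_const.smul hf

theorem contDiffOn_extDerivWithin {k : ℕ} {f : E → E [⋀^Fin k]→L[ℝ] ℝ} (hu : UniqueDiffOn ℝ D)
    (hf : ContDiffOn ℝ ∞ f D) : ContDiffOn ℝ ∞ (extDerivWithin f D) D :=
  (contDiff_alternatizeUncurryFinCLM k).comp_contDiffOn
    ((contDiffOn_infty_iff_fderivWithin hu).1 hf).2

theorem extDerivWithin_fun_sub {k : ℕ} {f g : E → E [⋀^Fin k]→L[ℝ] ℝ}
    (hu : UniqueDiffWithinAt ℝ D x) (hf : DifferentiableWithinAt ℝ f D x)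
    (hg : DifferentiableWithinAt ℝ g D x) :
    extDerivWithin (fun y => f y - g y) D x = extDerivWithin f D x - extDerivWithin g D x := by
  rw [extDerivWithin, fderivWithin_fun_sub hu hf hg, extDerivWithin, extDerivWithin,
    ← alternatizeUncurryFinCLM_apply, map_sub]
  rfl

theorem norm_compContinuousLinearMap_le_of_norm_le_one {k : ℕ} (g : F [⋀^Fin k]→L[ℝ] ℝ)
    {L : E →L[ℝ] F} (hL : ‖L‖ ≤ 1) : ‖g.compContinuousLinearMap L‖ ≤ ‖g‖ := by
  refine (g.norm_compContinuousLinearMap_le L).trans ?_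
  exact mul_le_of_le_one_right (norm_nonneg _) (pow_le_one₀ (norm_nonneg _) hL)

/-- Second derivatives of `φ` cancel by symmetry; at boundary points this symmetry is the reason for
requiring `x` in the closure of the interior. -/
theorem extDerivWithin_comp_pullback {k : ℕ} {f : F → F [⋀^Fin k]→L[ℝ] ℝ} {φ : E → F} {T : Set F}
    (hf : DifferentiableWithinAt ℝ f T (φ x)) (hφ : ContDiffWithinAt ℝ ∞ φ D x)
    (hu : UniqueDiffOn ℝ D) (hxc : x ∈ closure (interior D)) (hx : x ∈ D) (hDT : MapsTo φ D T) :
    extDerivWithin (fun y => (f (φ y)).compContinuousLinearMap (fderivWithin ℝ φ D y)) D x =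
      (extDerivWithin f T (φ x)).compContinuousLinearMap (fderivWithin ℝ φ D x) := by
  refine extDerivWithin_pullback hf hφ ?_ hu hxc hx hDT
  rw [minSmoothness_of_isRCLikeNormedField]
  exact WithTop.coe_le_coe.2 le_top

theorem extDerivWithin_extDerivWithin_eq_zero {k : ℕ} {f : E → E [⋀^Fin k]→L[ℝ] ℝ}
    (hu : UniqueDiffOn ℝ D) (hf : ContDiffOn ℝ ∞ f D) (hxc : x ∈ closure (interior D))
    (hx : x ∈ D) : extDerivWithin (extDerivWithin f D) D x = 0 := by
  refine extDerivWithin_extDerivWithin_apply (hf x hx) ?_ hu hxc hx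
  rw [minSmoothness_of_isRCLikeNormedField]
  exact WithTop.coe_le_coe.2 le_top

/-- The exterior derivative of a product with a function is controlled by those of the
factors. -/
theorem norm_extDerivWithin_smul_le {k : ℕ} {c : E → ℝ} {f : E → E [⋀^Fin k]→L[ℝ] ℝ}
    (hu : UniqueDiffWithinAt ℝ D x) (hc : DifferentiableWithinAt ℝ c D x)
    (hf : DifferentiableWithinAt ℝ f D x) :
    ‖extDerivWithin (fun y => c y • f y) D x‖ ≤
      |c x| * ‖extDerivWithin f D x‖ + (k + 1) * (‖fderivWithin ℝ c D x‖ * ‖f x‖) := by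
  rw [extDerivWithin, fderivWithin_fun_smul hu hc hf, alternatizeUncurryFin_add,
    alternatizeUncurryFin_smul]
  refine (norm_add_le _ _).trans (add_le_add ?_ ?_)
  · rw [norm_smul]; rfl
  · refine (norm_alternatizeUncurryFin_le _).trans ?_
    gcongr
    rw [ContinuousLinearMap.norm_smulRight_apply]

end Analysis

/-! ### Closed simplices and their charts -/

section Simplices

variable {V : Type u} [Fintype V]

section Geometry

variable {s t : Finset V} {x y : EuclideanSpace ℝ V}

theorem closedSimplex_mono (h : t ⊆ s) : closedSimplex t ⊆ closedSimplex s :=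
  fun _ hx => ⟨hx.1, fun i hi => hx.2.1 i fun hit => hi (h hit), hx.2.2⟩

theorem nonempty_of_mem_closedSimplex (hx : x ∈ closedSimplex s) : s.Nonempty := by
  by_contra h
  rw [Finset.not_nonempty_iff_eq_empty] at h
  have h1 : ∑ i, x i = 0 := Finset.sum_eq_zero fun i _ => hx.2.1 i (by simp [h])
  exact zero_ne_one (h1.symm.trans hx.2.2)

theorem le_one_of_mem_closedSimplex (hx : x ∈ closedSimplex s) (i : V) : x i ≤ 1 :=
  hx.2.2 ▸ Finset.single_le_sum (fun j _ => hx.1 j) (Finset.mem_univ i)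

theorem norm_le_one_of_mem_closedSimplex (hx : x ∈ closedSimplex s) : ‖x‖ ≤ 1 := by
  rw [← sq_le_one_iff₀ (norm_nonneg x), EuclideanSpace.norm_sq_eq, ← hx.2.2]
  refine Finset.sum_le_sum fun i _ => ?_
  rw [Real.norm_of_nonneg (hx.1 i), sq]
  exact mul_le_of_le_one_left (hx.1 i) (le_one_of_mem_closedSimplex hx i)

theorem convex_closedSimplex (s : Finset V) : Convex ℝ (closedSimplex s) := by
  intro x hx y hy a b ha hb hab
  refine ⟨fun i => ?_, fun i hi => ?_, ?_⟩
  · simpa using add_nonneg (mul_nonneg ha (hx.1 i)) (mul_nonneg hb (hy.1 i))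
  · simp [hx.2.1 i hi, hy.2.1 i hi]
  · simp [Finset.sum_add_distrib, ← Finset.mul_sum, hx.2.2, hy.2.2, hab]

theorem isCompact_closedSimplex (s : Finset V) : IsCompact (closedSimplex s) := by
  refine (isCompact_closedBall (0 : EuclideanSpace ℝ V) 1).of_isClosed_subset ?_ fun x hx => ?_
  · have h1 : closedSimplex s = (⋂ i, {x : EuclideanSpace ℝ V | 0 ≤ x i}) ∩
        ((⋂ i, {x | i ∉ s → x i = 0}) ∩ {x | ∑ i, x i = 1}) := by
      ext x; simp [closedSimplex]
    rw [h1]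
    refine (isClosed_iInter fun i => isClosed_le continuous_const (by fun_prop)).inter
      ((isClosed_iInter fun i => ?_).inter (isClosed_eq (by fun_prop) continuous_const))
    by_cases hi : i ∈ s
    · simp [hi]
    · simpa [hi] using isClosed_eq (f := fun x : EuclideanSpace ℝ V => x i) (by fun_prop)
        continuous_const
  · simpa using norm_le_one_of_mem_closedSimplex hx

/-- The orthogonal projection to the tangent space of a simplex. -/
def tangentProj (s : Finset V) : EuclideanSpace ℝ V →L[ℝ] simplexDir s :=
  (simplexDir s).orthogonalProjectionOnto

theorem tangentProj_coe (v : simplexDir s) : tangentProj s v = v :=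
  (simplexDir s).orthogonalProjectionOnto_mem_subspace_eq_self v

theorem coe_tangentProj {v : EuclideanSpace ℝ V} (hv : v ∈ simplexDir s) :
    (tangentProj s v : EuclideanSpace ℝ V) = v :=
  congrArg Subtype.val (tangentProj_coe (⟨v, hv⟩ : simplexDir s))

theorem norm_tangentProj_le (s : Finset V) : ‖tangentProj s‖ ≤ 1 :=
  (simplexDir s).orthogonalProjectionOnto_norm_le

theorem sub_mem_simplexDir (hx : x ∈ closedSimplex s) (hy : y ∈ closedSimplex s) :
    x - y ∈ simplexDir s :=
  ⟨fun i hi => by simp [hx.2.1 i hi, hy.2.1 i hi], by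
    simp [Finset.sum_sub_distrib, hx.2.2, hy.2.2]⟩

variable [DecidableEq V]

theorem single_mem_closedSimplex {i : V} (hi : i ∈ s) :
    EuclideanSpace.single i (1 : ℝ) ∈ closedSimplex s := by
  refine ⟨fun j => ?_, fun j hj => ?_, by simp⟩
  · by_cases h : j = i <;> simp [h]
  · have : j ≠ i := fun h => hj (h ▸ hi)
    simp [this]

theorem barycenter_apply (s : Finset V) (i : V) :
    barycenter s i = if i ∈ s then (s.card : ℝ)⁻¹ else 0 := by
  simp [barycenter, Finset.sum_apply, Pi.single_apply]

theorem barycenter_mem_closedSimplex (hs : s.Nonempty) : barycenter s ∈ closedSimplex s := by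
  refine ⟨fun i => ?_, fun i hi => by simp [barycenter_apply, hi], ?_⟩
  · rw [barycenter_apply]; positivity
  · simp only [barycenter_apply, Finset.sum_ite_mem, Finset.univ_inter, Finset.sum_const,
      nsmul_eq_mul]
    exact mul_inv_cancel₀ (by exact_mod_cast hs.card_pos.ne')

/-- The chart coordinates of a point. -/
def unchart (s : Finset V) (x : EuclideanSpace ℝ V) : simplexDir s :=
  tangentProj s (x - barycenter s)

theorem unchart_chart (v : simplexDir s) : unchart s (chart s v) = v := by
  simp [unchart, chart, tangentProj_coe]

theorem chart_unchart (hx : x ∈ closedSimplex s) : chart s (unchart s x) = x := by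
  rw [chart, unchart, coe_tangentProj (sub_mem_simplexDir hx
    (barycenter_mem_closedSimplex (nonempty_of_mem_closedSimplex hx)))]
  abel

theorem unchart_mem (hx : x ∈ closedSimplex s) : unchart s x ∈ chartDomain s := by
  rw [chartDomain, mem_ofPred_eq, chart_unchart hx]
  exact hx

theorem contDiff_chart (s : Finset V) : ContDiff ℝ ∞ (chart s) := by
  unfold chart
  exact contDiff_const.add (simplexDir s).subtypeL.contDiff

theorem contDiff_unchart (s : Finset V) : ContDiff ℝ ∞ (unchart s) :=
  (tangentProj s).contDiff.comp (contDiff_id.sub contDiff_const)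

theorem chartDomain_eq_image (s : Finset V) : chartDomain s = unchart s '' closedSimplex s := by
  ext v
  refine ⟨fun hv => ⟨chart s v, hv, unchart_chart v⟩, ?_⟩
  rintro ⟨x, hx, rfl⟩
  exact unchart_mem hx

theorem isCompact_chartDomain (s : Finset V) : IsCompact (chartDomain s) := by
  rw [chartDomain_eq_image]
  exact (isCompact_closedSimplex s).image (contDiff_unchart s).continuous

theorem chart_lineMap (s : Finset V) (v w : simplexDir s) (r : ℝ) :
    chart s (AffineMap.lineMap v w r) = AffineMap.lineMap (chart s v) (chart s w) r := by
  simp [chart, AffineMap.lineMap_apply]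
  abel

theorem convex_chartDomain (s : Finset V) : Convex ℝ (chartDomain s) := by
  rw [convex_iff_forall_pos]
  intro v hv w hw a b ha hb hab
  have h := convex_closedSimplex s hv hw ha.le hb.le hab
  have h2 : chart s (a • v + b • w) = a • chart s v + b • chart s w := by
    have h3 : barycenter s = a • barycenter s + b • barycenter s := by
      rw [← add_smul, hab, one_smul]
    simp only [chart, Submodule.coe_add, Submodule.coe_smul, smul_add]
    nth_rewrite 1 [h3]
    abel
  rwa [chartDomain, mem_ofPred_eq, h2]

theorem interior_chartDomain_nonempty (hs : s.Nonempty) : (interior (chartDomain s)).Nonempty := by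
  -- The origin of the chart is the barycentre, whose coordinates on `s` are positive; positivity of
  -- these finitely many coordinates is an open condition on tangent vectors.
  refine ⟨0, mem_interior.2 ⟨⋂ i : s, {v : simplexDir s | 0 < barycenter s i + v.1 i}, ?_, ?_, ?_⟩⟩
  · intro v hv
    simp only [mem_iInter, mem_ofPred_eq] at hv
    have hb := barycenter_mem_closedSimplex hs
    refine ⟨fun i => ?_, fun i hi => ?_, ?_⟩
    · by_cases hi : i ∈ s
      · exact (hv ⟨i, hi⟩).le
      · simp [chart, hb.2.1 i hi, v.2.1 i hi]
    · simp [chart, hb.2.1 i hi, v.2.1 i hi]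
    · simp [chart, Finset.sum_add_distrib, hb.2.2, v.2.2]
  · refine isOpen_iInter_of_finite fun i => isOpen_lt continuous_const ?_
    fun_prop
  · simp only [mem_iInter, mem_ofPred_eq]
    rintro ⟨i, hi⟩
    have := hs.card_pos
    simp [barycenter_apply, hi]
    exact ⟨i, hi⟩

theorem uniqueDiffOn_chartDomain (s : Finset V) : UniqueDiffOn ℝ (chartDomain s) := by
  intro v hv
  exact uniqueDiffOn_convex (convex_chartDomain s)
    (interior_chartDomain_nonempty (nonempty_of_mem_closedSimplex hv)) v hv

theorem subset_closure_interior_chartDomain (s : Finset V) :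
    chartDomain s ⊆ closure (interior (chartDomain s)) := by
  intro v hv
  rw [(convex_chartDomain s).closure_interior_eq_closure_of_nonempty_interior
    (interior_chartDomain_nonempty (nonempty_of_mem_closedSimplex hv))]
  exact subset_closure hv

/-- The inclusion of the tangent space of a face. -/
def faceIncl {t s : Finset V} (h : t ⊆ s) : simplexDir t →L[ℝ] simplexDir s :=
  (Submodule.inclusion (simplexDir_mono h)).mkContinuous 1 fun v => by simp

theorem coe_faceIncl (h : t ⊆ s) (v : simplexDir t) :
    (faceIncl h v : EuclideanSpace ℝ V) = v := rfl

theorem norm_faceIncl_le (h : t ⊆ s) : ‖faceIncl h‖ ≤ 1 :=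
  LinearMap.mkContinuous_norm_le _ zero_le_one _

theorem tangentProj_comp_subtypeL (h : t ⊆ s) :
    (tangentProj s).comp (simplexDir t).subtypeL = faceIncl h := by
  ext1 v
  exact tangentProj_coe (faceIncl h v)

theorem hasFDerivAt_unchart_chart (h : t ⊆ s) (v : simplexDir t) :
    HasFDerivAt (fun v => unchart s (chart t v)) (faceIncl h) v := by
  rw [← tangentProj_comp_subtypeL h]
  refine (tangentProj s).hasFDerivAt.comp v ?_
  exact ((simplexDir t).subtypeL.hasFDerivAt.const_add _).sub_const _

end Geometry

/-! ### Forms on one simplex: exterior derivative and restriction to faces -/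

section LocalForms

variable [DecidableEq V] {s t r : Finset V} {k : ℕ} {x : EuclideanSpace ℝ V}

/-- A form on the simplex spanned by `s`; only its values on the simplex are meaningful. -/
abbrev LocalForm (s : Finset V) (k : ℕ) : Type u :=
  EuclideanSpace ℝ V → simplexDir s [⋀^Fin k]→L[ℝ] ℝ

/-- Smoothness up to the boundary. -/
def IsSmooth (f : LocalForm s k) : Prop :=
  ContDiffOn ℝ ∞ (fun v => f (chart s v)) (chartDomain s)

/-- The exterior derivative on a simplex. -/
def extD (f : LocalForm s k) : LocalForm s (k + 1) := fun x =>
  extDerivWithin (fun v => f (chart s v)) (chartDomain s) (unchart s x)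

/-- The restriction of a form to a face. -/
def faceRes (h : t ⊆ s) (f : LocalForm s k) : LocalForm t k := fun x =>
  (f x).compContinuousLinearMap (faceIncl h)

theorem faceRes_faceRes (h : t ⊆ s) (h' : r ⊆ t) (f : LocalForm s k) :
    faceRes h' (faceRes h f) = faceRes (h'.trans h) f := rfl

theorem faceRes_add (h : t ⊆ s) (f g : LocalForm s k) :
    faceRes h (f + g) = faceRes h f + faceRes h g := rfl

theorem faceRes_sub (h : t ⊆ s) (f g : LocalForm s k) :
    faceRes h (f - g) = faceRes h f - faceRes h g := rfl

theorem faceRes_apply_eq_zero (h : t ⊆ s) {f : LocalForm s k} (hf : f x = 0) :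
    faceRes h f x = 0 := by
  ext w
  simp [faceRes, hf]

theorem norm_faceRes_le (h : t ⊆ s) (f : LocalForm s k) (x : EuclideanSpace ℝ V) :
    ‖faceRes h f x‖ ≤ ‖f x‖ :=
  norm_compContinuousLinearMap_le_of_norm_le_one (f x) (norm_faceIncl_le h)

namespace IsSmooth

variable {f g : LocalForm s k}

theorem zero : IsSmooth (0 : LocalForm s k) := contDiffOn_const

theorem add (hf : IsSmooth f) (hg : IsSmooth g) : IsSmooth (f + g) := ContDiffOn.add hf hg

theorem sub (hf : IsSmooth f) (hg : IsSmooth g) : IsSmooth (f - g) := ContDiffOn.sub hf hg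

theorem const_smul (c : ℝ) (hf : IsSmooth f) : IsSmooth (c • f) :=
  contDiffOn_const_smul c hf

theorem differentiableWithinAt (hf : IsSmooth f) {v : simplexDir s}
    (hv : v ∈ chartDomain s) :
    DifferentiableWithinAt ℝ (fun v => f (chart s v)) (chartDomain s) v :=
  (ContDiffOn.differentiableOn hf (by simp)) v hv

theorem continuousOn (hf : IsSmooth f) : ContinuousOn f (closedSimplex s) := by
  have h := ContinuousOn.comp (ContDiffOn.continuousOn hf)
    (contDiff_unchart s).continuous.continuousOn fun x (hx : x ∈ closedSimplex s) => unchart_mem hx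
  refine h.congr fun x hx => ?_
  simp [chart_unchart hx]

theorem extD (hf : IsSmooth f) : IsSmooth (extD f) := by
  refine (contDiffOn_extDerivWithin (uniqueDiffOn_chartDomain s) hf).congr fun v _ => ?_
  simp only [SimplicialForms.extD, unchart_chart]

theorem faceRes (h : t ⊆ s) (hf : IsSmooth f) : IsSmooth (faceRes h f) := by
  have h1 : ContDiffOn ℝ ∞ (fun v => f (chart t v)) (chartDomain t) := by
    have h2 : ContDiffOn ℝ ∞ (fun v => unchart s (chart t v)) (chartDomain t) :=
      ((contDiff_unchart s).comp (contDiff_chart t)).contDiffOn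
    refine (ContDiffOn.comp hf h2 fun v hv => unchart_mem (closedSimplex_mono h hv)).congr
      fun v hv => ?_
    simp [chart_unchart (closedSimplex_mono h hv)]
  exact (contDiff_compContinuousLinearMapCLM k (faceIncl h)).comp_contDiffOn h1

end IsSmooth

variable {f g : LocalForm s k}

theorem extD_congr (h : ∀ y ∈ closedSimplex s, f y = g y) (hx : x ∈ closedSimplex s) :
    extD f x = extD g x :=
  extDerivWithin_congr' (fun _ hv => h _ hv) (unchart_mem hx)

theorem extD_zero (x : EuclideanSpace ℝ V) : extD (0 : LocalForm s k) x = 0 := by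
  ext w
  simp [extD, extDerivWithin, ContinuousAlternatingMap.alternatizeUncurryFin_apply]

theorem extD_eq_zero (h : ∀ y ∈ closedSimplex s, f y = 0) (hx : x ∈ closedSimplex s) :
    extD f x = 0 :=
  (extD_congr (g := 0) h hx).trans (extD_zero x)

theorem extD_add (hf : IsSmooth f) (hg : IsSmooth g) (hx : x ∈ closedSimplex s) :
    extD (f + g) x = extD f x + extD g x :=
  extDerivWithin_add (uniqueDiffOn_chartDomain s _ (unchart_mem hx))
    (hf.differentiableWithinAt (unchart_mem hx)) (hg.differentiableWithinAt (unchart_mem hx))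

theorem extD_const_smul (c : ℝ) (hx : x ∈ closedSimplex s) : extD (c • f) x = c • extD f x :=
  extDerivWithin_smul c _ (uniqueDiffOn_chartDomain s _ (unchart_mem hx))

theorem extD_sub (hf : IsSmooth f) (hg : IsSmooth g) (hx : x ∈ closedSimplex s) :
    extD (f - g) x = extD f x - extD g x :=
  extDerivWithin_fun_sub (uniqueDiffOn_chartDomain s _ (unchart_mem hx))
    (hf.differentiableWithinAt (unchart_mem hx)) (hg.differentiableWithinAt (unchart_mem hx))

theorem extD_extD (hf : IsSmooth f) (hx : x ∈ closedSimplex s) : extD (extD f) x = 0 := by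
  have h := extDerivWithin_extDerivWithin_eq_zero (uniqueDiffOn_chartDomain s) hf
    (subset_closure_interior_chartDomain s (unchart_mem hx)) (unchart_mem hx)
  simp only [extD, unchart_chart]
  exact h

/-- The change of charts from a face to the simplex is affine with constant derivative `faceIncl h`,
so restriction is a pullback and commutes with the exterior derivative. -/
theorem extD_faceRes (h : t ⊆ s) (hf : IsSmooth f) (hx : x ∈ closedSimplex t) :
    extD (faceRes h f) x = faceRes h (extD f) x := by
  have hmaps : MapsTo (fun v => unchart s (chart t v)) (chartDomain t) (chartDomain s) :=
    fun v hv => unchart_mem (closedSimplex_mono h hv)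
  have hder : ∀ v ∈ chartDomain t,
      fderivWithin ℝ (fun v => unchart s (chart t v)) (chartDomain t) v = faceIncl h := fun v hv =>
    (hasFDerivAt_unchart_chart h v).hasFDerivWithinAt.fderivWithin
      (uniqueDiffOn_chartDomain t v hv)
  have hv := unchart_mem hx
  have h1 := extDerivWithin_comp_pullback (f := fun v => f (chart s v))
    (φ := fun v => unchart s (chart t v)) (x := unchart t x)
    (hf.differentiableWithinAt (hmaps hv))
    (((contDiff_unchart s).comp (contDiff_chart t)).contDiffAt.contDiffWithinAt)
    (uniqueDiffOn_chartDomain t)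
    (subset_closure_interior_chartDomain t hv) hv hmaps
  rw [hder _ hv] at h1
  simp only [chart_unchart hx] at h1
  rw [faceRes, extD, extD, ← h1]
  refine extDerivWithin_congr' (fun v hv => ?_) hv
  simp only [hder v hv, chart_unchart (closedSimplex_mono h hv), faceRes]

end LocalForms

end Simplices

/-! ### The cone operator on a simplex -/

section ConeOperator

variable {V : Type u} [Fintype V]

section Cone

variable [DecidableEq V] {s t : Finset V} {m : ℕ} {p x : EuclideanSpace ℝ V}

/-- The cone operator on forms on a simplex, with apex `p`. -/
def coneOp (p : EuclideanSpace ℝ V) (f : LocalForm s (m + 1)) : LocalForm s m := fun x =>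
  coneForm (unchart s p) (fun v => f (chart s v)) (unchart s x)

variable {f : LocalForm s (m + 1)}

theorem IsSmooth.coneOp (hp : p ∈ closedSimplex s) (hf : IsSmooth f) :
    IsSmooth (coneOp p f) := by
  refine (contDiffOn_coneForm (convex_chartDomain s) (isCompact_chartDomain s)
    (uniqueDiffOn_chartDomain s) (unchart_mem hp) hf).congr fun v _ => ?_
  simp only [SimplicialForms.coneOp, unchart_chart]

theorem extD_coneOp (hp : p ∈ closedSimplex s) (hf : IsSmooth f) (hx : x ∈ closedSimplex s) :
    extD (coneOp p f) x + coneOp p (extD f) x = f x := by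
  have h := extDerivWithin_coneForm (convex_chartDomain s) (isCompact_chartDomain s)
    (uniqueDiffOn_chartDomain s) (unchart_mem hp) (unchart_mem hx) hf
  rw [chart_unchart hx] at h
  simp only [extD, coneOp, unchart_chart]
  exact h

theorem coneOp_extD_zero {f : LocalForm s 0} (hp : p ∈ closedSimplex s) (hf : IsSmooth f)
    (hx : x ∈ closedSimplex s) : coneOp p (extD f) x = f x - f p := by
  have h := coneForm_extDerivWithin_zero (convex_chartDomain s)
    (uniqueDiffOn_chartDomain s) (unchart_mem hp) (unchart_mem hx) hf
  rw [chart_unchart hx, chart_unchart hp] at h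
  simp only [extD, coneOp, unchart_chart]
  exact h

theorem coneOp_congr (hp : p ∈ closedSimplex s) {g : LocalForm s (m + 1)}
    (h : ∀ y ∈ closedSimplex s, f y = g y) (hx : x ∈ closedSimplex s) :
    coneOp p f x = coneOp p g x := by
  rw [coneOp, coneForm, coneAverage_congr (g := fun v => g (chart s v)) (convex_chartDomain s)
    (unchart_mem hp) (unchart_mem hx) fun v hv => h _ hv]
  rfl

theorem coneOp_eq_zero (hp : p ∈ closedSimplex s)
    (h : ∀ y ∈ closedSimplex s, f y = 0) (hx : x ∈ closedSimplex s) : coneOp p f x = 0 := by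
  rw [coneOp_congr (g := 0) hp h hx]
  simp [coneOp, coneForm, coneAverage]

theorem norm_coneOp_le (hp : p ∈ closedSimplex s) {M : ℝ}
    (h : ∀ y ∈ closedSimplex s, ‖f y‖ ≤ M) (hx : x ∈ closedSimplex s) :
    ‖coneOp p f x‖ ≤ 2 * M := by
  have hM : 0 ≤ M := (norm_nonneg (f x)).trans (h x hx)
  refine (norm_coneForm_le (convex_chartDomain s) (unchart_mem hp) (unchart_mem hx)
    fun v hv => h _ hv).trans ?_
  rw [mul_comm]
  gcongr
  -- The factor `2` bounds `‖x - p‖`, since points of the simplex have norm at most `1`.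
  have h1 : unchart s x - unchart s p = tangentProj s (x - p) := by simp [unchart]
  rw [h1]
  refine (ContinuousLinearMap.le_of_opNorm_le _ (norm_tangentProj_le s) _).trans ?_
  rw [one_mul]
  refine (norm_sub_le _ _).trans ?_
  have := norm_le_one_of_mem_closedSimplex hx
  have := norm_le_one_of_mem_closedSimplex hp
  linarith

theorem coneOp_apply (hp : p ∈ closedSimplex s) (hf : IsSmooth f) (hx : x ∈ closedSimplex s)
    (w : Fin m → simplexDir s) :
    coneOp p f x w = ∫ r in (0 : ℝ)..1, r ^ m *
      f (AffineMap.lineMap p x r) (Matrix.vecCons (tangentProj s (x - p)) w) := by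
  have h1 : unchart s x - unchart s p = tangentProj s (x - p) := by
    simp [unchart]
  rw [coneOp, coneForm, ContinuousAlternatingMap.curryLeft_apply_apply, h1]
  have h2 := map_coneAverage (convex_chartDomain s) (unchart_mem hp) (unchart_mem hx)
    (ContDiffOn.continuousOn hf) m
    (ContinuousAlternatingMap.apply ℝ (simplexDir s) ℝ (Matrix.vecCons (tangentProj s (x - p)) w))
  refine h2.trans ?_
  simp only [coneAverage, chart_lineMap, chart_unchart hp, chart_unchart hx]
  rfl

/-- For an apex and a point in the same face, both the segment and the radial vector lie in that
face, so the integral formula only sees the restricted form. -/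
theorem faceRes_coneOp (h : t ⊆ s) (hp : p ∈ closedSimplex t) (hf : IsSmooth f)
    (hx : x ∈ closedSimplex t) : faceRes h (coneOp p f) x = coneOp p (faceRes h f) x := by
  ext w
  rw [coneOp_apply hp (hf.faceRes h) hx]
  change coneOp p f x (faceIncl h ∘ w) = _
  rw [coneOp_apply (closedSimplex_mono h hp) hf (closedSimplex_mono h hx)]
  have h1 : tangentProj s (x - p) = faceIncl h (tangentProj t (x - p)) := by
    ext1
    rw [coe_faceIncl, coe_tangentProj (sub_mem_simplexDir hx hp),
      coe_tangentProj (simplexDir_mono h (sub_mem_simplexDir hx hp))]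
  have h2 : Matrix.vecCons (tangentProj s (x - p)) (faceIncl h ∘ w) =
      faceIncl h ∘ Matrix.vecCons (tangentProj t (x - p)) w := by
    rw [h1]
    ext1 j
    refine Fin.cases ?_ (fun j => ?_) j <;> simp
  rw [h2]
  rfl

end Cone

end ConeOperator

/-! ### Pullbacks damped by a cutoff function -/

section Cutoff

variable {E F : Type u} [NormedAddCommGroup E] [NormedSpace ℝ E] [NormedAddCommGroup F]
  [NormedSpace ℝ F] {D U O : Set E} {T : Set F} {φ : E → F} {c : E → ℝ} {k : ℕ}
  {f : F → F [⋀^Fin k]→L[ℝ] ℝ} {x : E}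

theorem contDiffOn_pullback [FiniteDimensional ℝ E] [FiniteDimensional ℝ F] (hU : IsOpen U)
    (hφ : ContDiffOn ℝ ∞ φ U) (hf : ContDiffOn ℝ ∞ f T) (hmaps : MapsTo φ (D ∩ U) T) :
    ContDiffOn ℝ ∞ (fun y => (f (φ y)).compContinuousLinearMap (fderiv ℝ φ y)) (D ∩ U) := by
  have h1 : ContDiffOn ℝ ∞ (fun y => f (φ y)) (D ∩ U) :=
    hf.comp (hφ.mono inter_subset_right) hmaps
  have h2 : ContDiffOn ℝ ∞ (fderiv ℝ φ) (D ∩ U) :=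
    (((contDiffOn_infty_iff_fderiv_of_isOpen hU).1 hφ).2).mono inter_subset_right
  exact (contDiff_compContinuousLinearMap k).comp_contDiffOn (h1.prodMk h2)

/-- A cutoff function times the pullback of a form is smooth when the cutoff vanishes where the
map is not defined. -/
theorem contDiffOn_cutoff_pullback [FiniteDimensional ℝ E] [FiniteDimensional ℝ F]
    (hU : IsOpen U) (hO : IsOpen O) (hUO : D ⊆ U ∪ O) (hc : ContDiff ℝ ∞ c)
    (hcO : ∀ y ∈ D ∩ O, c y = 0) (hφ : ContDiffOn ℝ ∞ φ U) (hf : ContDiffOn ℝ ∞ f T)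
    (hmaps : MapsTo φ (D ∩ U) T) :
    ContDiffOn ℝ ∞ (fun y => c y • (f (φ y)).compContinuousLinearMap (fderiv ℝ φ y)) D := by
  refine contDiffOn_of_locally_contDiffOn fun y hy => ?_
  rcases hUO hy with hyU | hyO
  · exact ⟨U, hU, hyU, hc.contDiffOn.smul (contDiffOn_pullback hU hφ hf hmaps)⟩
  · refine ⟨O, hO, hyO, (contDiffOn_const (c := 0)).congr fun z hz => ?_⟩
    rw [hcO z hz, zero_smul]

theorem exists_bound_fderiv {F : Type*} [NormedAddCommGroup F] [NormedSpace ℝ F] {φ : E → F}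
    {K : Set E} (hK : IsCompact K) (hU : IsOpen U) (hKU : K ⊆ U) (hφ : ContDiffOn ℝ ∞ φ U) :
    ∃ L : ℝ, 0 ≤ L ∧ ∀ x ∈ K, ‖fderiv ℝ φ x‖ ≤ L := by
  obtain ⟨L, hL⟩ := hK.exists_bound_of_continuousOn
    (((contDiffOn_infty_iff_fderiv_of_isOpen hU).1 hφ).2.continuousOn.mono hKU)
  exact ⟨max L 0, le_max_right _ _, fun x hx => (hL x hx).trans (le_max_left _ _)⟩

theorem extDerivWithin_inter {f : E → E [⋀^Fin k]→L[ℝ] ℝ} (hU : U ∈ 𝓝 x) :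
    extDerivWithin f (D ∩ U) x = extDerivWithin f D x := by
  rw [extDerivWithin, extDerivWithin, fderivWithin_inter hU]

theorem extDerivWithin_pullback_of_isOpen (hU : IsOpen U) (hu : UniqueDiffOn ℝ D)
    (hφ : ContDiffOn ℝ ∞ φ U) (hf : ContDiffOn ℝ ∞ f T) (hmaps : MapsTo φ (D ∩ U) T)
    (hxc : x ∈ closure (interior D)) (hxD : x ∈ D) (hxU : x ∈ U) :
    extDerivWithin (fun y => (f (φ y)).compContinuousLinearMap (fderiv ℝ φ y)) D x =
      (extDerivWithin f T (φ x)).compContinuousLinearMap (fderiv ℝ φ x) := by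
  have hu' : UniqueDiffOn ℝ (D ∩ U) := hu.inter hU
  have hder : ∀ y ∈ D ∩ U, fderivWithin ℝ φ (D ∩ U) y = fderiv ℝ φ y := fun y hy =>
    ((hφ.differentiableOn (by simp)).differentiableAt (hU.mem_nhds hy.2)).fderivWithin (hu' y hy)
  have hx : x ∈ D ∩ U := ⟨hxD, hxU⟩
  have hxc' : x ∈ closure (interior (D ∩ U)) := by
    rw [interior_inter, hU.interior_eq]
    exact hU.closure_inter ⟨hxc, hxU⟩
  have h := extDerivWithin_comp_pullback (f := f)
    ((hf.differentiableOn (by simp)) _ (hmaps hx))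
    ((hφ.mono inter_subset_right) x hx) hu' hxc' hx hmaps
  rw [hder x hx] at h
  rw [← h, ← extDerivWithin_inter (hU.mem_nhds hxU)]
  exact extDerivWithin_congr' (fun y hy => by simp only [hder y hy]) hx

theorem norm_cutoff_pullback_le {L M : ℝ} (hx : c x ≠ 0 → φ x ∈ T)
    (hcx : |c x| ≤ 1) (hL : c x ≠ 0 → ‖fderiv ℝ φ x‖ ≤ L) (hL0 : 0 ≤ L) (hM0 : 0 ≤ M)
    (hM : ∀ y ∈ T, ‖f y‖ ≤ M) :
    ‖c x • (f (φ x)).compContinuousLinearMap (fderiv ℝ φ x)‖ ≤ L ^ k * M := by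
  by_cases h : c x = 0
  · rw [h, zero_smul, norm_zero]; positivity
  rw [norm_smul, Real.norm_eq_abs]
  refine (mul_le_of_le_one_left (norm_nonneg _) hcx).trans ?_
  refine ((f (φ x)).norm_compContinuousLinearMap_le _).trans ?_
  rw [mul_comm, Fintype.card_fin]
  exact mul_le_mul (pow_le_pow_left₀ (norm_nonneg _) (hL h) _) (hM _ (hx h)) (norm_nonneg _)
    (by positivity)

/-- On `O` the product is locally zero. Elsewhere the Leibniz rule applies and the pullback commutes
with `d`, so no derivative of `f` beyond its exterior derivative is needed; this keeps the estimate
within comass norms. -/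
theorem norm_extDerivWithin_cutoff_pullback_le [FiniteDimensional ℝ E] [FiniteDimensional ℝ F]
    (hU : IsOpen U) (hO : IsOpen O) (hUO : D ⊆ U ∪ O) (hu : UniqueDiffOn ℝ D)
    (hc : ContDiff ℝ ∞ c) (hcO : ∀ y ∈ D ∩ O, c y = 0) (hφ : ContDiffOn ℝ ∞ φ U)
    (hf : ContDiffOn ℝ ∞ f T) (hmaps : MapsTo φ (D ∩ U) T) (hxc : x ∈ closure (interior D))
    (hxD : x ∈ D) {L B M M' : ℝ} (hcx : |c x| ≤ 1) (hcB : ‖fderiv ℝ c x‖ ≤ B)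
    (hL : x ∉ O → ‖fderiv ℝ φ x‖ ≤ L) (hL0 : 0 ≤ L) (hM0 : 0 ≤ M) (hM0' : 0 ≤ M')
    (hM : ∀ y ∈ T, ‖f y‖ ≤ M) (hM' : ∀ y ∈ T, ‖extDerivWithin f T y‖ ≤ M') :
    ‖extDerivWithin (fun y => c y • (f (φ y)).compContinuousLinearMap (fderiv ℝ φ y)) D x‖ ≤
      L ^ (k + 1) * M' + (k + 1) * (B * (L ^ k * M)) := by
  have hB0 : 0 ≤ B := (norm_nonneg (fderiv ℝ c x)).trans hcB
  by_cases hxO : x ∈ O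
  · have h0 : extDerivWithin (fun y => c y • (f (φ y)).compContinuousLinearMap (fderiv ℝ φ y))
        D x = 0 := by
      rw [← extDerivWithin_inter (hO.mem_nhds hxO)]
      have h1 : EqOn (fun y => c y • (f (φ y)).compContinuousLinearMap (fderiv ℝ φ y))
          (fun _ => 0) (D ∩ O) := fun y hy => by simp only [hcO y hy, zero_smul]
      rw [extDerivWithin_congr' h1 ⟨hxD, hxO⟩]
      ext w
      simp [extDerivWithin, ContinuousAlternatingMap.alternatizeUncurryFin_apply]
    rw [h0, norm_zero]
    positivity
  have hxU : x ∈ U := (hUO hxD).resolve_right hxO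
  have hφx := hmaps ⟨hxD, hxU⟩
  have hdiff : DifferentiableWithinAt ℝ
      (fun y => (f (φ y)).compContinuousLinearMap (fderiv ℝ φ y)) D x :=
    (((contDiffOn_pullback hU hφ hf hmaps).differentiableOn (by simp)) x
      ⟨hxD, hxU⟩).mono_of_mem_nhdsWithin
      (Filter.inter_mem self_mem_nhdsWithin (mem_nhdsWithin_of_mem_nhds (hU.mem_nhds hxU)))
  have hcd : DifferentiableAt ℝ c x := hc.contDiffAt.differentiableAt (by simp)
  refine (norm_extDerivWithin_smul_le (hu x hxD) hcd.differentiableWithinAt hdiff).trans ?_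
  rw [extDerivWithin_pullback_of_isOpen hU hu hφ hf hmaps hxc hxD hxU,
    hcd.fderivWithin (hu x hxD)]
  refine add_le_add ?_ ?_
  · refine (mul_le_of_le_one_left (norm_nonneg _) hcx).trans ?_
    refine (ContinuousAlternatingMap.norm_compContinuousLinearMap_le _ _).trans ?_
    rw [mul_comm, Fintype.card_fin]
    exact mul_le_mul (pow_le_pow_left₀ (norm_nonneg _) (hL hxO) _) (hM' _ hφx) (norm_nonneg _)
      (by positivity)
  · gcongr
    refine (ContinuousAlternatingMap.norm_compContinuousLinearMap_le _ _).trans ?_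
    rw [mul_comm, Fintype.card_fin]
    exact mul_le_mul (pow_le_pow_left₀ (norm_nonneg _) (hL hxO) _) (hM _ hφx) (norm_nonneg _)
      (by positivity)

end Cutoff

/-! ### Extending a form from the facet opposite to a vertex -/

section Extension

variable {V : Type u} [Fintype V] [DecidableEq V] {s t : Finset V} {k : ℕ} {i : V}
  {x : EuclideanSpace ℝ V}

/-- The radial projection from the vertex `i` to the opposite face. -/
def radialProj (i : V) (x : EuclideanSpace ℝ V) : EuclideanSpace ℝ V :=
  (1 - x i)⁻¹ • (x - x i • EuclideanSpace.single i 1)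

/-- The derivative of the radial projection. -/
def radialProjDeriv (i : V) (x w : EuclideanSpace ℝ V) : EuclideanSpace ℝ V :=
  (1 - x i)⁻¹ • (w - w i • EuclideanSpace.single i 1) +
    (((1 - x i) ^ 2)⁻¹ * w i) • (x - x i • EuclideanSpace.single i 1)

theorem radialProj_mem (hx : x ∈ closedSimplex t) (hi : x i < 1) :
    radialProj i x ∈ closedSimplex (t.erase i) := by
  have h1 : 0 < 1 - x i := by linarith
  refine ⟨fun j => ?_, fun j hj => ?_, ?_⟩
  · by_cases hj : j = i
    · simp [radialProj, hj]
    · simpa [radialProj, hj] using mul_nonneg (inv_nonneg.2 h1.le) (hx.1 j)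
  · by_cases hji : j = i
    · simp [radialProj, hji]
    · have : j ∉ t := fun h => hj (Finset.mem_erase.2 ⟨hji, h⟩)
      simp [radialProj, hji, hx.2.1 j this]
  · simp [radialProj, ← Finset.mul_sum, Finset.sum_sub_distrib, hx.2.2, inv_mul_cancel₀ h1.ne']

theorem radialProjDeriv_mem (hx : x ∈ closedSimplex t) (hi : x i < 1) {w : EuclideanSpace ℝ V}
    (hw : w ∈ simplexDir t) : radialProjDeriv i x w ∈ simplexDir (t.erase i) := by
  have h1 : 1 - x i ≠ 0 := by linarith
  refine ⟨fun j hj => ?_, ?_⟩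
  · by_cases hji : j = i
    · simp [radialProjDeriv, hji]
    · have : j ∉ t := fun h => hj (Finset.mem_erase.2 ⟨hji, h⟩)
      simp [radialProjDeriv, hji, hx.2.1 j this, hw.1 j this]
  · simp [radialProjDeriv, ← Finset.mul_sum, Finset.sum_sub_distrib, Finset.sum_add_distrib,
      hx.2.2, hw.2]
    field_simp
    ring

theorem radialProj_eq_self (hx : x i = 0) : radialProj i x = x := by
  simp [radialProj, hx]

theorem radialProjDeriv_eq_self (hx : x i = 0)
    {w : EuclideanSpace ℝ V} (hw : w i = 0) : radialProjDeriv i x w = w := by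
  simp [radialProjDeriv, hx, hw]

/-- The radial projection read in charts. -/
def chartRadialProj (s : Finset V) (i : V) (v : simplexDir s) : simplexDir (s.erase i) :=
  unchart (s.erase i) (radialProj i (chart s v))

theorem contDiffOn_chartRadialProj (s : Finset V) (i : V) :
    ContDiffOn ℝ ∞ (chartRadialProj s i) {v | chart s v i < 1} := by
  have hcoord : ContDiff ℝ ∞ fun v : simplexDir s => chart s v i :=
    (EuclideanSpace.proj (𝕜 := ℝ) i).contDiff.comp (contDiff_chart s)
  have h : ContDiffOn ℝ ∞ (fun v : simplexDir s => (1 - chart s v i)⁻¹ •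
      (chart s v - chart s v i • EuclideanSpace.single i (1 : ℝ))) {v | chart s v i < 1} := by
    have h1 : ContDiffOn ℝ ∞ (fun v : simplexDir s => (1 - chart s v i)⁻¹)
        {v | chart s v i < 1} := by
      refine (contDiff_const.sub hcoord).contDiffOn.inv fun v hv => ?_
      have : chart s v i < 1 := hv
      linarith
    exact h1.smul ((contDiff_chart s).sub (hcoord.smul contDiff_const)).contDiffOn
  exact (contDiff_unchart _).comp_contDiffOn h

theorem hasFDerivAt_radialProj (i : V) (hx : x i ≠ 1) :
    ∃ L : EuclideanSpace ℝ V →L[ℝ] EuclideanSpace ℝ V,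
      HasFDerivAt (radialProj i) L x ∧ ∀ w, L w = radialProjDeriv i x w := by
  have h1 : HasFDerivAt (fun y : EuclideanSpace ℝ V => y i) (EuclideanSpace.proj (𝕜 := ℝ) i) x :=
    (EuclideanSpace.proj (𝕜 := ℝ) i).hasFDerivAt
  have h2 := (hasDerivAt_inv (sub_ne_zero.2 hx.symm)).comp_hasFDerivAt x (h1.const_sub 1)
  have h3 := (hasFDerivAt_id x).sub (h1.smul_const (EuclideanSpace.single i (1 : ℝ)))
  refine ⟨_, h2.smul h3, fun w => ?_⟩
  ext j
  simp [radialProjDeriv]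

/-- The derivative of the radial projection is already tangent to the opposite face, so the
orthogonal projection hidden in `unchart` leaves it unchanged. -/
theorem coe_fderiv_chartRadialProj {v : simplexDir s} (hv : v ∈ chartDomain s)
    (hi : chart s v i < 1) (w : simplexDir s) :
    (fderiv ℝ (chartRadialProj s i) v w : EuclideanSpace ℝ V) =
      radialProjDeriv i (chart s v) w := by
  obtain ⟨L, hL, hLw⟩ := hasFDerivAt_radialProj i hi.ne
  have h1 : HasFDerivAt (chart s) (simplexDir s).subtypeL v :=
    (simplexDir s).subtypeL.hasFDerivAt.const_add _
  have h2 : HasFDerivAt (chartRadialProj s i)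
      ((tangentProj (s.erase i)).comp (L.comp (simplexDir s).subtypeL)) v :=
    (tangentProj (s.erase i)).hasFDerivAt.comp v ((hL.comp v h1).sub_const _)
  rw [h2.fderiv]
  change ((tangentProj (s.erase i) (L w) : simplexDir (s.erase i)) : EuclideanSpace ℝ V) = _
  rw [hLw, coe_tangentProj (radialProjDeriv_mem hv hi w.2)]

/-- A smooth function equal to `1` at `0` and vanishing on `[1/2, ∞)`. -/
def cutoff (r : ℝ) : ℝ := Real.smoothTransition (1 - 2 * r)

theorem cutoff_zero : cutoff 0 = 1 := by
  simp [cutoff, Real.smoothTransition.one_of_one_le]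

theorem cutoff_eq_zero {r : ℝ} (hr : 1 / 2 ≤ r) : cutoff r = 0 :=
  Real.smoothTransition.zero_of_nonpos (by linarith)

theorem abs_cutoff_le (r : ℝ) : |cutoff r| ≤ 1 := by
  rw [cutoff, abs_of_nonneg (Real.smoothTransition.nonneg _)]
  exact Real.smoothTransition.le_one _

theorem contDiff_cutoff_coord (s : Finset V) (i : V) :
    ContDiff ℝ ∞ fun v : simplexDir s => cutoff (chart s v i) := by
  have hcoord : ContDiff ℝ ∞ fun v : simplexDir s => chart s v i :=
    (EuclideanSpace.proj (𝕜 := ℝ) i).contDiff.comp (contDiff_chart s)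
  exact Real.smoothTransition.contDiff.comp (contDiff_const.sub (contDiff_const.mul hcoord))

/-- Extension to a simplex of a form on the face opposite to the vertex `i`. -/
def extOp (i : V) (f : LocalForm (s.erase i) k) : LocalForm s k := fun x =>
  cutoff (x i) • (f (radialProj i x)).compContinuousLinearMap
    (fderiv ℝ (chartRadialProj s i) (unchart s x))

theorem isOpen_coord_lt (s : Finset V) (i : V) (r : ℝ) :
    IsOpen {v : simplexDir s | chart s v i < r} :=
  isOpen_lt ((EuclideanSpace.proj (𝕜 := ℝ) i).continuous.comp (contDiff_chart s).continuous)
    continuous_const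

theorem isOpen_lt_coord (s : Finset V) (i : V) (r : ℝ) :
    IsOpen {v : simplexDir s | r < chart s v i} :=
  isOpen_lt continuous_const
    ((EuclideanSpace.proj (𝕜 := ℝ) i).continuous.comp (contDiff_chart s).continuous)

theorem mapsTo_chartRadialProj (s : Finset V) (i : V) :
    MapsTo (chartRadialProj s i) (chartDomain s ∩ {v | chart s v i < 1})
      (chartDomain (s.erase i)) :=
  fun _ hv => unchart_mem (radialProj_mem hv.1 hv.2)

theorem coord_cover (s : Finset V) (i : V) :
    chartDomain s ⊆ {v | chart s v i < 1} ∪ {v | 1 / 2 < chart s v i} := by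
  intro v _
  by_cases h : chart s v i < 1
  · exact Or.inl h
  · exact Or.inr (lt_of_lt_of_le (by norm_num) (not_lt.1 h))

theorem extOp_chart (f : LocalForm (s.erase i) k) {v : simplexDir s} (hv : v ∈ chartDomain s) :
    extOp i f (chart s v) = cutoff (chart s v i) •
      (f (chart (s.erase i) (chartRadialProj s i v))).compContinuousLinearMap
        (fderiv ℝ (chartRadialProj s i) v) := by
  by_cases h : chart s v i < 1
  · rw [extOp, unchart_chart, chartRadialProj, chart_unchart (radialProj_mem hv h)]
  · rw [extOp, cutoff_eq_zero (by linarith), zero_smul, zero_smul]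

theorem IsSmooth.extOp {f : LocalForm (s.erase i) k} (hf : IsSmooth f) :
    IsSmooth (extOp (s := s) i f) := by
  refine (contDiffOn_cutoff_pullback (isOpen_coord_lt s i 1) (isOpen_lt_coord s i (1 / 2))
    (coord_cover s i) (contDiff_cutoff_coord s i) (fun v hv => cutoff_eq_zero (le_of_lt hv.2))
    (contDiffOn_chartRadialProj s i) hf (mapsTo_chartRadialProj s i)).congr fun v hv => ?_
  exact extOp_chart f hv

/-- Where `x i = 0` the cutoff is `1`, and the radial projection fixes the face together with its
tangent vectors. -/
theorem faceRes_extOp_self (h : s.erase i ⊆ s) (f : LocalForm (s.erase i) k)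
    (hx : x ∈ closedSimplex (s.erase i)) : faceRes h (extOp i f) x = f x := by
  have hxi : x i = 0 := hx.2.1 i (by simp)
  have hxs := closedSimplex_mono h hx
  ext w
  have h1 : ∀ j, fderiv ℝ (chartRadialProj s i) (unchart s x) (faceIncl h (w j)) = w j := by
    intro j
    ext1
    rw [coe_fderiv_chartRadialProj (unchart_mem hxs) (by rw [chart_unchart hxs, hxi]; norm_num),
      chart_unchart hxs, radialProjDeriv_eq_self hxi]
    · rfl
    · exact (w j).2.1 i (by simp)
  simp only [faceRes, extOp, hxi, cutoff_zero, one_smul, radialProj_eq_self hxi,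
    ContinuousAlternatingMap.compContinuousLinearMap_apply]
  congr 1
  ext1 j
  exact h1 j

/-- The radial projection carries `t` into `t.erase i` and tangent vectors of the first to tangent
vectors of the second. Thus a correction on one facet does not disturb faces where its data already
vanish. -/
theorem faceRes_extOp_eq_zero (h : t ⊆ s) {f : LocalForm (s.erase i) k}
    (hf : ∀ y ∈ closedSimplex (t.erase i), faceRes (Finset.erase_subset_erase i h) f y = 0)
    (hx : x ∈ closedSimplex t) : faceRes h (extOp i f) x = 0 := by
  have hxs := closedSimplex_mono h hx
  by_cases hi : x i < 1
  · ext w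
    have h1 : ∀ j, fderiv ℝ (chartRadialProj s i) (unchart s x) (faceIncl h (w j)) =
        faceIncl (Finset.erase_subset_erase i h)
          ⟨radialProjDeriv i x (w j), radialProjDeriv_mem hx hi (w j).2⟩ := by
      intro j
      ext1
      rw [coe_fderiv_chartRadialProj (unchart_mem hxs) (by rwa [chart_unchart hxs]),
        chart_unchart hxs]
      rfl
    have h2 := DFunLike.congr_fun (hf _ (radialProj_mem hx hi))
      fun j => ⟨radialProjDeriv i x (w j), radialProjDeriv_mem hx hi (w j).2⟩
    change cutoff (x i) • f (radialProj i x)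
      (fun j => fderiv ℝ (chartRadialProj s i) (unchart s x) (faceIncl h (w j))) = 0
    simp only [h1]
    exact (congrArg (cutoff (x i) • ·) h2).trans (smul_zero _)
  · ext w
    simp [faceRes, extOp, cutoff_eq_zero (show 1 / 2 ≤ x i by linarith)]

/-- The radial projection degenerates only at the vertex `i`; on the compact part `x i ≤ 1 / 2`,
outside which the cutoff vanishes, its derivative is bounded. -/
theorem exists_norm_extOp_le (s : Finset V) (i : V) (k : ℕ) : ∃ C : ℝ, 0 ≤ C ∧
    ∀ f : LocalForm (s.erase i) k, IsSmooth f → ∀ M M' : ℝ, 0 ≤ M → 0 ≤ M' →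
      (∀ y ∈ closedSimplex (s.erase i), ‖f y‖ ≤ M) →
      (∀ y ∈ closedSimplex (s.erase i), ‖extD f y‖ ≤ M') →
      ∀ x ∈ closedSimplex s, ‖extOp (s := s) i f x‖ ≤ C * M ∧
        ‖extD (extOp (s := s) i f) x‖ ≤ C * (M + M') := by
  obtain ⟨L', hL0, hL⟩ := exists_bound_fderiv ((isCompact_chartDomain s).inter_right
    (isOpen_lt_coord s i (1 / 2)).isClosed_compl) (isOpen_coord_lt s i 1)
    (fun v hv => by
      have h : ¬ (1 / 2 < chart s v i) := hv.2
      have h' : chart s v i < 1 := by linarith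
      exact h') (contDiffOn_chartRadialProj s i)
  obtain ⟨B', hB0, hB⟩ := exists_bound_fderiv (isCompact_chartDomain s) isOpen_univ
    (subset_univ _) (contDiff_cutoff_coord s i).contDiffOn
  -- The summands bound the form, the pullback of its exterior derivative, and the term where the
  -- cutoff is differentiated; `L'` bounds the derivative of the projection, `B'` that of the
  -- cutoff.
  refine ⟨L' ^ k + L' ^ (k + 1) + (k + 1) * (B' * L' ^ k), by positivity, ?_⟩
  intro f hf M M' hM0 hM0' hM hM' x hx
  have hv := unchart_mem hx
  constructor
  · have h1 := norm_cutoff_pullback_le (f := fun v => f (chart (s.erase i) v))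
      (φ := chartRadialProj s i) (c := fun v => cutoff (chart s v i)) (x := unchart s x)
      (T := chartDomain (s.erase i)) (L := L') (M := M) ?_ (abs_cutoff_le _) ?_ hL0 hM0
      (fun v hv => hM _ hv)
    · rw [← extOp_chart f hv, chart_unchart hx] at h1
      refine h1.trans ?_
      gcongr
      have : 0 ≤ L' ^ (k + 1) := by positivity
      have : 0 ≤ (k + 1) * (B' * L' ^ k) := by positivity
      linarith
    · intro hne
      refine mapsTo_chartRadialProj s i ⟨hv, ?_⟩
      by_contra hcon
      exact hne (cutoff_eq_zero (by
        have : ¬ (chart s (unchart s x) i < 1) := hcon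
        linarith))
    · intro hne
      refine hL _ ⟨hv, ?_⟩
      intro hcon
      exact hne (cutoff_eq_zero (le_of_lt hcon))
  · have h1 := norm_extDerivWithin_cutoff_pullback_le (isOpen_coord_lt s i 1)
      (isOpen_lt_coord s i (1 / 2)) (coord_cover s i) (uniqueDiffOn_chartDomain s)
      (contDiff_cutoff_coord s i) (fun v hv => cutoff_eq_zero (le_of_lt hv.2))
      (contDiffOn_chartRadialProj s i) hf (mapsTo_chartRadialProj s i)
      (subset_closure_interior_chartDomain s hv) hv (abs_cutoff_le _)
      (hB _ hv)
      (fun hO => hL _ ⟨hv, hO⟩) hL0 hM0 hM0' (fun v hv => hM _ hv)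
      (fun v hv => by
        have h2 := hM' _ hv
        rwa [extD, unchart_chart] at h2)
    have h3 : extD (extOp (s := s) i f) x = extDerivWithin (fun v => cutoff (chart s v i) •
        (f (chart (s.erase i) (chartRadialProj s i v))).compContinuousLinearMap
        (fderiv ℝ (chartRadialProj s i) v)) (chartDomain s) (unchart s x) :=
      extDerivWithin_congr' (fun v hv => extOp_chart f hv) hv
    rw [h3]
    refine h1.trans ?_
    have h4 : 0 ≤ L' ^ k * (M + M') := by positivity
    have h5 : 0 ≤ L' ^ (k + 1) * M := by positivity
    have h6 : 0 ≤ (k + 1) * (B' * L' ^ k) * M' := by positivity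
    calc L' ^ (k + 1) * M' + (k + 1) * (B' * (L' ^ k * M))
        ≤ L' ^ (k + 1) * M' + (k + 1) * (B' * (L' ^ k * M)) + (L' ^ k * (M + M')
          + L' ^ (k + 1) * M + (k + 1) * (B' * L' ^ k) * M') := by linarith
      _ = _ := by ring

end Extension

/-! ### Integration over the coordinate simplex in cone coordinates -/

section Measure

open MeasureTheory

/-- The coordinate simplex in `ℝᵏ`. -/
def coordSimplex (k : ℕ) : Set (Fin k → ℝ) := {y | (∀ j, 0 ≤ y j) ∧ ∑ j, y j ≤ 1}

theorem isCompact_coordSimplex (k : ℕ) : IsCompact (coordSimplex k) := by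
  refine (isCompact_univ_pi fun _ : Fin k => isCompact_Icc (a := (0 : ℝ))
    (b := 1)).of_isClosed_subset ?_ fun y hy j _ => ⟨hy.1 j, ?_⟩
  · have h : coordSimplex k = (⋂ j, {y : Fin k → ℝ | 0 ≤ y j}) ∩ {y | ∑ j, y j ≤ 1} := by
      ext y; simp [coordSimplex]
    rw [h]
    exact (isClosed_iInter fun j => isClosed_le continuous_const (by fun_prop)).inter
      (isClosed_le (by fun_prop) continuous_const)
  · exact (Finset.single_le_sum (fun l _ => hy.1 l) (Finset.mem_univ j)).trans hy.2

/-- The cone parametrization of the coordinate simplex, with apex the last unit vector. -/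
def conePt {k : ℕ} (r : ℝ) (z : Fin k → ℝ) : Fin (k + 1) → ℝ :=
  (Fin.last k).insertNth (1 - r) (r • z)

theorem conePt_last {k : ℕ} (r : ℝ) (z : Fin k → ℝ) : conePt r z (Fin.last k) = 1 - r := by
  simp [conePt]

theorem conePt_castSucc {k : ℕ} (r : ℝ) (z : Fin k → ℝ) (j : Fin k) :
    conePt r z j.castSucc = r * z j := by
  rw [← Fin.succAbove_last, conePt, Fin.insertNth_apply_succAbove, Pi.smul_apply, smul_eq_mul]

theorem insertNth_last_mem_coordSimplex {k : ℕ} (a : ℝ) (y : Fin k → ℝ) :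
    (Fin.last k).insertNth a y ∈ coordSimplex (k + 1) ↔
      0 ≤ a ∧ (∀ j, 0 ≤ y j) ∧ a + ∑ j, y j ≤ 1 := by
  have h1 : (∀ j, 0 ≤ ((Fin.last k).insertNth a y : Fin (k + 1) → ℝ) j) ↔
      0 ≤ a ∧ ∀ j, 0 ≤ y j := by
    rw [Fin.forall_iff_succAbove (Fin.last k)]
    simp
  have h2 : ∑ j, ((Fin.last k).insertNth a y : Fin (k + 1) → ℝ) j = a + ∑ j, y j := by
    rw [Fin.sum_univ_succAbove _ (Fin.last k)]
    simp
  change (∀ j, 0 ≤ ((Fin.last k).insertNth a y : Fin (k + 1) → ℝ) j) ∧ _ ≤ (1 : ℝ) ↔ _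
  rw [h1, h2, and_assoc]

theorem conePt_mem_iff {k : ℕ} {r : ℝ} (hr : 0 < r) (hr1 : r ≤ 1) (z : Fin k → ℝ) :
    conePt r z ∈ coordSimplex (k + 1) ↔ z ∈ coordSimplex k := by
  rw [conePt, insertNth_last_mem_coordSimplex]
  simp only [Pi.smul_apply, smul_eq_mul, ← Finset.mul_sum]
  constructor
  · rintro ⟨_, h1, h2⟩
    refine ⟨fun j => nonneg_of_mul_nonneg_right (h1 j) hr, ?_⟩
    have : r * ∑ j, z j ≤ r * 1 := by linarith
    exact le_of_mul_le_mul_left this hr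
  · rintro ⟨h1, h2⟩
    refine ⟨by linarith, fun j => mul_nonneg hr.le (h1 j), ?_⟩
    have : r * ∑ j, z j ≤ r * 1 := mul_le_mul_of_nonneg_left h2 hr.le
    linarith

theorem conePt_mem {k : ℕ} {r : ℝ} (hr : r ∈ Icc (0 : ℝ) 1) {z : Fin k → ℝ}
    (hz : z ∈ coordSimplex k) : conePt r z ∈ coordSimplex (k + 1) := by
  rw [conePt, insertNth_last_mem_coordSimplex]
  simp only [Pi.smul_apply, smul_eq_mul, ← Finset.mul_sum]
  refine ⟨by linarith [hr.2], fun j => mul_nonneg hr.1 (hz.1 j), ?_⟩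
  have : r * ∑ j, z j ≤ r * 1 := mul_le_mul_of_nonneg_left hz.2 hr.1
  linarith

theorem continuous_conePt {k : ℕ} : Continuous fun q : ℝ × (Fin k → ℝ) => conePt q.1 q.2 := by
  refine continuous_pi fun j => ?_
  induction j using Fin.succAboveCases (Fin.last k) with
  | x =>
    simp only [conePt, Fin.insertNth_apply_same]
    fun_prop
  | p j =>
    simp only [conePt, Fin.insertNth_apply_succAbove, Pi.smul_apply, smul_eq_mul]
    fun_prop

theorem integrable_cone_integrand {k : ℕ} {G : (Fin (k + 1) → ℝ) → ℝ}
    (hG : ContinuousOn G (coordSimplex (k + 1))) :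
    Integrable (fun q : ℝ × (Fin k → ℝ) => q.1 ^ k * G (conePt q.1 q.2))
      ((volume.restrict (Ioc (0 : ℝ) 1)).prod (volume.restrict (coordSimplex k))) := by
  rw [Measure.prod_restrict]
  have h1 : ContinuousOn (fun q : ℝ × (Fin k → ℝ) => q.1 ^ k * G (conePt q.1 q.2))
      (Icc (0 : ℝ) 1 ×ˢ coordSimplex k) :=
    (continuous_fst.pow k).continuousOn.mul
      (hG.comp continuous_conePt.continuousOn fun q hq => conePt_mem hq.1 hq.2)
  have h2 : IntegrableOn (fun q : ℝ × (Fin k → ℝ) => q.1 ^ k * G (conePt q.1 q.2))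
      (Icc (0 : ℝ) 1 ×ˢ coordSimplex k) (volume.prod volume) :=
    h1.integrableOn_compact (isCompact_Icc.prod (isCompact_coordSimplex k))
  exact h2.mono_set (prod_mono Ioc_subset_Icc_self subset_rfl)

/-- Integration over the coordinate simplex in cone coordinates. -/
theorem integral_coordSimplex_succ {k : ℕ} {G : (Fin (k + 1) → ℝ) → ℝ}
    (hG : ContinuousOn G (coordSimplex (k + 1))) :
    ∫ y in coordSimplex (k + 1), G y =
      ∫ z in coordSimplex k, ∫ r in (0 : ℝ)..1, r ^ k * G (conePt r z) := by
  have hmp := (volume_preserving_piFinSuccAbove (fun _ : Fin (k + 1) => ℝ) (Fin.last k)).symm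
  set e := MeasurableEquiv.piFinSuccAbove (fun _ : Fin (k + 1) => ℝ) (Fin.last k) with he
  have hsymm : ∀ a : ℝ, ∀ y : Fin k → ℝ, e.symm (a, y) = (Fin.last k).insertNth a y :=
    fun a y => rfl
  set H : ℝ × (Fin k → ℝ) → ℝ := (e.symm ⁻¹' coordSimplex (k + 1)).indicator (G ∘ e.symm) with hH
  have hms : MeasurableSet (e.symm ⁻¹' coordSimplex (k + 1)) :=
    e.symm.measurable (isCompact_coordSimplex (k + 1)).isClosed.measurableSet
  have hint : Integrable H (volume.prod volume) := by
    rw [hH, integrable_indicator_iff hms]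
    exact (hmp.integrableOn_comp_preimage e.symm.measurableEmbedding).2
      (hG.integrableOn_compact (isCompact_coordSimplex (k + 1)))
  have h1 : ∫ y in coordSimplex (k + 1), G y = ∫ a, ∫ y, H (a, y) := by
    rw [← hmp.setIntegral_preimage_emb e.symm.measurableEmbedding, ← integral_prod H hint, hH,
      integral_indicator hms]
    rfl
  -- The simplex is sliced by its last coordinate; slices outside `[0, 1]` are empty.
  have h0 : ∀ a ∉ Icc (0 : ℝ) 1, ∫ y, H (a, y) = 0 := by
    intro a ha
    refine integral_eq_zero_of_ae (Filter.Eventually.of_forall fun y => ?_)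
    refine indicator_of_notMem (fun hmem => ha ?_) _
    rw [mem_preimage, hsymm, insertNth_last_mem_coordSimplex] at hmem
    have hnn := Finset.sum_nonneg fun j (_ : j ∈ Finset.univ) => hmem.2.1 j
    exact ⟨hmem.1, by linarith [hmem.2.2]⟩
  have h2 : ∫ a, ∫ y, H (a, y) = ∫ a in (0 : ℝ)..1, ∫ y, H (a, y) := by
    rw [intervalIntegral.integral_of_le zero_le_one, ← integral_Icc_eq_integral_Ioc,
      setIntegral_eq_integral_of_forall_compl_eq_zero h0]
  have h3 : ∫ a in (0 : ℝ)..1, ∫ y, H (a, y) = ∫ r in (0 : ℝ)..1, ∫ y, H (1 - r, y) := by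
    rw [intervalIntegral.integral_comp_sub_left (fun a => ∫ y, H (a, y)) 1]
    simp
  -- The slice at height `1 - r` is the `r`-dilate of the smaller coordinate simplex, so rescaling
  -- produces the Jacobian `r ^ k`, the same weight as in the cone operator on forms of degree `k +
  -- 1`.
  have h4 : ∀ r ∈ Ioc (0 : ℝ) 1, ∫ y, H (1 - r, y) =
      ∫ z in coordSimplex k, r ^ k * G (conePt r z) := by
    intro r hr
    have h5 := Measure.integral_comp_smul (volume : Measure (Fin k → ℝ))
      (fun y => H (1 - r, y)) r
    have hr0 : r ^ k ≠ 0 := pow_ne_zero _ hr.1.ne'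
    rw [Module.finrank_fin_fun, abs_of_nonneg (inv_nonneg.2 (pow_nonneg hr.1.le k)),
      smul_eq_mul] at h5
    rw [integral_const_mul, ← integral_indicator
      (isCompact_coordSimplex k).isClosed.measurableSet]
    have h6 : ∀ z, (coordSimplex k).indicator (fun z => G (conePt r z)) z = H (1 - r, r • z) := by
      intro z
      by_cases hz : z ∈ coordSimplex k
      · rw [indicator_of_mem hz, hH, indicator_of_mem]
        · rfl
        · exact (conePt_mem_iff hr.1 hr.2 z).2 hz
      · rw [indicator_of_notMem hz, hH, indicator_of_notMem]
        exact fun h => hz ((conePt_mem_iff hr.1 hr.2 z).1 h)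
    simp only [h6]
    rw [h5, mul_inv_cancel_left₀ hr0]
  rw [h1, h2, h3]
  simp only [intervalIntegral.integral_of_le zero_le_one]
  rw [setIntegral_congr_fun measurableSet_Ioc h4]
  exact integral_integral_swap (integrable_cone_integrand hG)

end Measure

/-! ### Integrals over simplices and Stokes' theorem -/

section Stokes

open MeasureTheory

variable {V : Type u} [Fintype V] [LinearOrder V] {s t : Finset V} {k : ℕ}

/-- The edge vectors from the first vertex of `s` to the others. -/
def edges (s : Finset V) (hs : s.card = k + 1) (j : Fin k) : simplexDir s :=
  edgeVec s (s.orderEmbOfFin hs 0) (s.orderEmbOfFin hs j.succ)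
    (s.orderEmbOfFin_mem hs 0) (s.orderEmbOfFin_mem hs j.succ)

/-- The affine parametrization of the simplex spanned by `s` by the coordinate simplex. -/
def simplexPt (s : Finset V) (hs : s.card = k + 1) (y : Fin k → ℝ) : EuclideanSpace ℝ V :=
  EuclideanSpace.single (s.orderEmbOfFin hs 0) 1 + ∑ j, y j • (edges s hs j).val

/-- The integral of a form of top degree over a simplex. -/
def simplexIntegral (s : Finset V) (hs : s.card = k + 1) (f : LocalForm s k) : ℝ :=
  ∫ y in coordSimplex k, f (simplexPt s hs y) (edges s hs)

theorem coe_edges (hs : s.card = k + 1) (j : Fin k) : (edges s hs j : EuclideanSpace ℝ V) =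
    EuclideanSpace.single (s.orderEmbOfFin hs j.succ) 1 -
      EuclideanSpace.single (s.orderEmbOfFin hs 0) 1 := rfl

theorem simplexPt_mem (hs : s.card = k + 1) {y : Fin k → ℝ} (hy : y ∈ coordSimplex k) :
    simplexPt s hs y ∈ closedSimplex s := by
  have h1 : simplexPt s hs y = ∑ j : Fin (k + 1), (Fin.cons (1 - ∑ j, y j) y : Fin (k + 1) → ℝ) j •
      EuclideanSpace.single (s.orderEmbOfFin hs j) (1 : ℝ) := by
    rw [Fin.sum_univ_succ]
    simp only [simplexPt, coe_edges, smul_sub, Finset.sum_sub_distrib, Fin.cons_zero,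
      Fin.cons_succ, ← Finset.sum_smul, sub_smul, one_smul]
    abel
  rw [h1]
  refine (convex_closedSimplex s).sum_mem (fun j _ => ?_) ?_ fun j _ =>
    single_mem_closedSimplex (s.orderEmbOfFin_mem hs j)
  · refine Fin.cases ?_ (fun j => ?_) j
    · simpa using hy.2
    · simpa using hy.1 j
  · rw [Fin.sum_univ_succ]
    simp

theorem continuous_simplexPt (hs : s.card = k + 1) : Continuous (simplexPt s hs) := by
  unfold simplexPt
  fun_prop

theorem continuousOn_simplexIntegrand (hs : s.card = k + 1) {f : LocalForm s k}
    (hf : IsSmooth f) (w : Fin k → simplexDir s) :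
    ContinuousOn (fun y => f (simplexPt s hs y) w) (coordSimplex k) := by
  have h1 := hf.continuousOn.comp (continuous_simplexPt hs).continuousOn
    fun y hy => simplexPt_mem hs hy
  exact (ContinuousAlternatingMap.apply ℝ (simplexDir s) ℝ w).continuous.comp_continuousOn h1

theorem simplexIntegral_congr (hs : s.card = k + 1) {f g : LocalForm s k}
    (h : ∀ x ∈ closedSimplex s, f x = g x) : simplexIntegral s hs f = simplexIntegral s hs g := by
  refine setIntegral_congr_fun (isCompact_coordSimplex k).isClosed.measurableSet fun y hy => ?_
  simp only [h _ (simplexPt_mem hs hy)]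

theorem simplexIntegral_eq_zero (hs : s.card = k + 1) {f : LocalForm s k}
    (h : ∀ x ∈ closedSimplex s, f x = 0) : simplexIntegral s hs f = 0 := by
  rw [simplexIntegral_congr (g := 0) hs h]
  simp [simplexIntegral]

theorem simplexIntegral_add (hs : s.card = k + 1) {f g : LocalForm s k} (hf : IsSmooth f)
    (hg : IsSmooth g) :
    simplexIntegral s hs (f + g) = simplexIntegral s hs f + simplexIntegral s hs g :=
  integral_add ((continuousOn_simplexIntegrand hs hf _).integrableOn_compact
    (isCompact_coordSimplex k)) ((continuousOn_simplexIntegrand hs hg _).integrableOn_compact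
    (isCompact_coordSimplex k))

theorem simplexIntegral_sub (hs : s.card = k + 1) {f g : LocalForm s k} (hf : IsSmooth f)
    (hg : IsSmooth g) :
    simplexIntegral s hs (f - g) = simplexIntegral s hs f - simplexIntegral s hs g :=
  integral_sub ((continuousOn_simplexIntegrand hs hf _).integrableOn_compact
    (isCompact_coordSimplex k)) ((continuousOn_simplexIntegrand hs hg _).integrableOn_compact
    (isCompact_coordSimplex k))

theorem simplexIntegral_const_smul (hs : s.card = k + 1) (c : ℝ) (f : LocalForm s k) :
    simplexIntegral s hs (c • f) = c * simplexIntegral s hs f :=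
  integral_const_mul c _

theorem simplexIntegral_zero_form (hs : s.card = 1) (f : LocalForm s 0) (w : Fin 0 → simplexDir s) :
    simplexIntegral s hs f = f (EuclideanSpace.single (s.orderEmbOfFin hs 0) 1) w := by
  have h1 : coordSimplex 0 = univ := by ext y; simp [coordSimplex]
  rw [simplexIntegral, h1, Measure.restrict_univ, Measure.volume_pi_eq_dirac 0, integral_dirac,
    Subsingleton.elim (edges s hs) w]
  simp [simplexPt]

/-- An increasing enumeration is unique. This identifies the vertex orders, hence the orientations,
of iterated faces. -/
theorem orderEmbOfFin_erase {n : ℕ} (hs : s.card = n + 1) (i : Fin (n + 1))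
    (h : (s.erase (s.orderEmbOfFin hs i)).card = n) (j : Fin n) :
    (s.erase (s.orderEmbOfFin hs i)).orderEmbOfFin h j = s.orderEmbOfFin hs (i.succAbove j) := by
  have h1 := Finset.orderEmbOfFin_unique h (f := fun j => s.orderEmbOfFin hs (i.succAbove j))
    (fun j => Finset.mem_erase.2 ⟨fun hj => Fin.succAbove_ne i j
      ((s.orderEmbOfFin hs).injective hj), s.orderEmbOfFin_mem hs _⟩)
    ((s.orderEmbOfFin hs).strictMono.comp (Fin.strictMono_succAbove i))
  exact (congrFun h1 j).symm

theorem card_erase_orderEmbOfFin {n : ℕ} (hs : s.card = n + 1) (i : Fin (n + 1)) :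
    (s.erase (s.orderEmbOfFin hs i)).card = n := by
  rw [Finset.card_erase_of_mem (s.orderEmbOfFin_mem hs i), hs, Nat.add_sub_cancel]

/-- The last vertex. -/
abbrev lastVertex (s : Finset V) {n : ℕ} (hs : s.card = n + 1) : V :=
  s.orderEmbOfFin hs (Fin.last n)

section ConeIntegral

variable (hs : s.card = k + 2) (hF : (s.erase (lastVertex s hs)).card = k + 1)

theorem faceIncl_edges (j : Fin k) :
    faceIncl (Finset.erase_subset _ s) (edges (s.erase (lastVertex s hs)) hF j) =
      edges s hs j.castSucc := by
  ext1
  rw [coe_faceIncl, coe_edges, coe_edges, orderEmbOfFin_erase, orderEmbOfFin_erase]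
  simp

theorem simplexPt_sub_apex (z : Fin k → ℝ) :
    simplexPt (s.erase (lastVertex s hs)) hF z - EuclideanSpace.single (lastVertex s hs) 1 =
      -(edges s hs (Fin.last k)).val + ∑ j, z j • (edges s hs (Fin.castSucc j)).val := by
  have h1 : ∀ j, (edges (s.erase (lastVertex s hs)) hF j).val = (edges s hs j.castSucc).val :=
    fun j => congrArg Subtype.val (faceIncl_edges hs hF j)
  rw [simplexPt, orderEmbOfFin_erase]
  simp only [h1]
  rw [coe_edges hs (Fin.last k)]
  simp
  abel

theorem lineMap_apex_simplexPt (r : ℝ) (z : Fin k → ℝ) :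
    AffineMap.lineMap (EuclideanSpace.single (lastVertex s hs) (1 : ℝ))
      (simplexPt (s.erase (lastVertex s hs)) hF z) r = simplexPt s hs (conePt r z) := by
  rw [AffineMap.lineMap_apply, vsub_eq_sub, vadd_eq_add, simplexPt_sub_apex, simplexPt,
    Fin.sum_univ_castSucc]
  simp only [conePt_last, conePt_castSucc, mul_smul, ← Finset.smul_sum]
  rw [coe_edges hs (Fin.last k)]
  simp only [Fin.succ_last, smul_add, smul_neg, smul_sub, sub_smul, one_smul]
  abel

/-- The sum over `j` drops out because it repeats vectors already present. Moving the last edge from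
the first to the last slot costs `(-1) ^ k`, and its coefficient `-1` gives one more sign. -/
theorem form_vecCons_apex (g : simplexDir s [⋀^Fin (k + 1)]→L[ℝ] ℝ) (z : Fin k → ℝ) :
    g (Matrix.vecCons (-(edges s hs (Fin.last k)) + ∑ j, z j • edges s hs (Fin.castSucc j))
      fun j => edges s hs (Fin.castSucc j)) = (-1) ^ (k + 1) * g (edges s hs) := by
  rw [← ContinuousAlternatingMap.curryLeft_apply_apply, map_add, map_neg, map_sum]
  simp only [map_smul]
  rw [ContinuousAlternatingMap.add_apply, ContinuousAlternatingMap.sum_apply,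
    Finset.sum_eq_zero, add_zero, ContinuousAlternatingMap.neg_apply,
    ContinuousAlternatingMap.curryLeft_apply_apply]
  · have h1 := g.neg_one_pow_smul_map_insertNth (Fin.last k) (edges s hs (Fin.last k))
      fun j => edges s hs (Fin.castSucc j)
    have h2 : (Fin.last k).insertNth (edges s hs (Fin.last k))
        (fun j => edges s hs (Fin.castSucc j)) = edges s hs := by
      rw [Fin.insertNth_eq_iff]
      refine ⟨rfl, ?_⟩
      ext1 j
      simp [Fin.removeNth]
    rw [← h1, h2]
    simp [pow_succ]
  · intro j _
    rw [ContinuousAlternatingMap.smul_apply, ContinuousAlternatingMap.curryLeft_apply_apply]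
    rw [g.map_eq_zero_of_eq (i := 0) (j := j.succ) _ (by simp) (Fin.succ_ne_zero j).symm,
      smul_zero]

/-- The integral over a simplex in terms of the cone operator at the last vertex. -/
theorem simplexIntegral_eq_coneOp {f : LocalForm s (k + 1)} (hf : IsSmooth f) :
    simplexIntegral s hs f = (-1) ^ (k + 1) * simplexIntegral (s.erase (lastVertex s hs)) hF
      (faceRes (Finset.erase_subset _ s)
        (coneOp (EuclideanSpace.single (lastVertex s hs) 1) f)) := by
  -- In cone coordinates with apex the last vertex, the inner integral over `r` is the cone operator
  -- evaluated on the opposite facet, up to sign.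
  rw [simplexIntegral, integral_coordSimplex_succ (continuousOn_simplexIntegrand hs hf _),
    simplexIntegral, ← integral_const_mul]
  refine setIntegral_congr_fun (isCompact_coordSimplex k).isClosed.measurableSet fun z hz => ?_
  have hx := closedSimplex_mono (Finset.erase_subset (lastVertex s hs) s) (simplexPt_mem hF hz)
  have hp : EuclideanSpace.single (lastVertex s hs) 1 ∈ closedSimplex s :=
    single_mem_closedSimplex (s.orderEmbOfFin_mem hs _)
  have h1 : faceRes (Finset.erase_subset _ s)
      (coneOp (EuclideanSpace.single (lastVertex s hs) 1) f)
      (simplexPt (s.erase (lastVertex s hs)) hF z) (edges (s.erase (lastVertex s hs)) hF) =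
      coneOp (EuclideanSpace.single (lastVertex s hs) 1) f
        (simplexPt (s.erase (lastVertex s hs)) hF z) (fun j => edges s hs (Fin.castSucc j)) := by
    change coneOp _ f _ (fun j => faceIncl _ (edges _ hF j)) = _
    simp only [faceIncl_edges]
  have h2 : tangentProj s (simplexPt (s.erase (lastVertex s hs)) hF z -
      EuclideanSpace.single (lastVertex s hs) 1) =
      -(edges s hs (Fin.last k)) + ∑ j, z j • edges s hs (Fin.castSucc j) := by
    rw [simplexPt_sub_apex, map_add, map_neg, map_sum]
    simp only [map_smul, tangentProj_coe]
  simp only [h1, coneOp_apply hp hf hx, h2, form_vecCons_apex, lineMap_apex_simplexPt]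
  rw [← intervalIntegral.integral_const_mul]
  refine intervalIntegral.integral_congr fun r _ => ?_
  have h3 : ((-1 : ℝ) ^ (k + 1)) * (-1) ^ (k + 1) = 1 := by
    rw [← mul_pow]; simp
  change r ^ k * f (simplexPt s hs (conePt r z)) (edges s hs) = (-1) ^ (k + 1) *
    (r ^ k * ((-1) ^ (k + 1) * f (simplexPt s hs (conePt r z)) (edges s hs)))
  linear_combination (-(r ^ k * f (simplexPt s hs (conePt r z)) (edges s hs))) * h3

end ConeIntegral

theorem simplexIntegral_faceRes_congr {t t' : Finset V} (h : t = t') (ht : t ⊆ s) (ht' : t' ⊆ s)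
    (hc : t.card = k + 1) (hc' : t'.card = k + 1) (f : LocalForm s k) :
    simplexIntegral t hc (faceRes ht f) = simplexIntegral t' hc' (faceRes ht' f) := by
  subst h
  rfl

/-- Stokes' theorem on a simplex. -/
theorem simplexIntegral_extD (hs : s.card = k + 2) {f : LocalForm s k} (hf : IsSmooth f) :
    simplexIntegral s hs (extD f) = ∑ i : Fin (k + 2), (-1) ^ (i : ℕ) *
      simplexIntegral (s.erase (s.orderEmbOfFin hs i)) (card_erase_orderEmbOfFin hs i)
        (faceRes (Finset.erase_subset _ s) f) := by
  induction k generalizing s with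
  | zero =>
    have hp : EuclideanSpace.single (lastVertex s hs) 1 ∈ closedSimplex s :=
      single_mem_closedSimplex (s.orderEmbOfFin_mem hs _)
    rw [simplexIntegral_eq_coneOp hs (card_erase_orderEmbOfFin hs _) hf.extD]
    rw [Fin.sum_univ_castSucc, Fin.sum_univ_one]
    simp only [simplexIntegral_zero_form _ _ 0, orderEmbOfFin_erase]
    have h0 : ∀ (i : V) (g : LocalForm s 0) (x : EuclideanSpace ℝ V),
        faceRes (Finset.erase_subset i s) g x 0 = g x 0 := fun i g x =>
      congrArg (g x) (Subsingleton.elim _ _)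
    simp only [h0]
    rw [coneOp_extD_zero hp hf (single_mem_closedSimplex (s.orderEmbOfFin_mem hs _))]
    have e1 : (Fin.last (0 + 1)).succAbove (0 : Fin 1) = 0 := rfl
    have e2 : (0 : Fin 1).castSucc.succAbove (0 : Fin 1) = Fin.last (0 + 1) := rfl
    simp only [e1, e2, lastVertex, ContinuousAlternatingMap.sub_apply]
    simp
    ring
  | succ k ih =>
    set q := lastVertex s hs with hq
    have hF := card_erase_orderEmbOfFin hs (Fin.last (k + 2))
    have hqs : q ∈ s := s.orderEmbOfFin_mem hs _
    have hp : EuclideanSpace.single q 1 ∈ closedSimplex s := single_mem_closedSimplex hqs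
    set c := coneOp (EuclideanSpace.single q 1) f with hc
    have hcs : IsSmooth c := hf.coneOp hp
    -- The homotopy formula `h(df) = f - d(hf)` on the facet opposite to `q`. The term `f` yields
    -- the last summand of Stokes; the term `d(hf)` is handled by induction.
    have h1 : simplexIntegral (s.erase q) hF (faceRes (Finset.erase_subset _ s)
        (coneOp (EuclideanSpace.single q 1) (extD f))) =
        simplexIntegral (s.erase q) hF (faceRes (Finset.erase_subset _ s) f) -
        simplexIntegral (s.erase q) hF (extD (faceRes (Finset.erase_subset _ s) c)) := by
      rw [← simplexIntegral_sub hF (hf.faceRes _) (hcs.faceRes _).extD]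
      refine simplexIntegral_congr hF fun x hx => ?_
      have h2 := extD_coneOp hp hf (closedSimplex_mono (Finset.erase_subset q s) hx)
      rw [Pi.sub_apply, extD_faceRes _ hcs hx]
      ext w
      simp [faceRes, ← h2, hc]
    -- A facet of the facet opposite to `q` is also the facet opposite to `q` in another facet `G`
    -- of `s`, whose last vertex is still `q`. Reading the cone formula backwards on `G` turns the
    -- integral of the cone into the integral of `f` over `G`.
    have h3 : ∀ j : Fin (k + 2),
        simplexIntegral ((s.erase q).erase ((s.erase q).orderEmbOfFin hF j))
          (card_erase_orderEmbOfFin hF j) (faceRes (Finset.erase_subset _ (s.erase q))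
            (faceRes (Finset.erase_subset q s) c)) =
        (-1) ^ (k + 1) * simplexIntegral (s.erase (s.orderEmbOfFin hs j.castSucc))
          (card_erase_orderEmbOfFin hs j.castSucc) (faceRes (Finset.erase_subset _ s) f) := by
      intro j
      set G := s.erase (s.orderEmbOfFin hs j.castSucc) with hG
      have hGc : G.card = k + 2 := card_erase_orderEmbOfFin hs j.castSucc
      have hGs : G ⊆ s := Finset.erase_subset _ s
      have hqG : lastVertex G hGc = q := by
        rw [lastVertex, orderEmbOfFin_erase hs j.castSucc, hq, lastVertex]
        congr 1
        rw [Fin.succAbove_of_le_castSucc]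
        · rfl
        · exact Fin.castSucc_le_castSucc_iff.2 (Fin.le_last j)
      have hGF := card_erase_orderEmbOfFin hGc (Fin.last (k + 1))
      rw [simplexIntegral_eq_coneOp hGc hGF (hf.faceRes hGs), ← mul_assoc, ← mul_pow]
      have hset : (s.erase q).erase ((s.erase q).orderEmbOfFin hF j) =
          G.erase (lastVertex G hGc) := by
        rw [hqG, orderEmbOfFin_erase hs (Fin.last (k + 2)), Fin.succAbove_last,
          Finset.erase_right_comm]
      have hsub : G.erase (lastVertex G hGc) ⊆ s := (Finset.erase_subset _ _).trans hGs
      rw [faceRes_faceRes, simplexIntegral_faceRes_congr hset _ hsub _ hGF c]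
      simp only [neg_mul_neg, one_mul, one_pow]
      refine simplexIntegral_congr hGF fun x hx => ?_
      have hxG := closedSimplex_mono (Finset.erase_subset _ G) hx
      have h4 := faceRes_coneOp hGs
        (single_mem_closedSimplex (G.orderEmbOfFin_mem hGc (Fin.last (k + 1)))) hf hxG
      have hc' : c = coneOp (EuclideanSpace.single (lastVertex G hGc) 1) f := by rw [hqG]
      rw [hc']
      rw [← faceRes_faceRes hGs (Finset.erase_subset _ G)]
      exact congrArg (fun g => ContinuousAlternatingMap.compContinuousLinearMap g
        (faceIncl (Finset.erase_subset _ G))) h4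
    have hih := (ih hF (hcs.faceRes (Finset.erase_subset q s))).trans
      (Finset.sum_congr rfl fun j _ => congrArg ((-1 : ℝ) ^ (j : ℕ) * ·) (h3 j))
    rw [Fin.sum_univ_castSucc, simplexIntegral_eq_coneOp hs hF hf.extD, h1, hih, mul_sub,
      Finset.mul_sum, sub_eq_add_neg, add_comm]
    congr 1
    rw [← Finset.sum_neg_distrib]
    refine Finset.sum_congr rfl fun j _ => ?_
    have h5 : ((-1 : ℝ) ^ (k + 1)) * (-1) ^ (k + 1) = 1 := by
      rw [← mul_pow]; simp
    set I := simplexIntegral (s.erase (s.orderEmbOfFin hs j.castSucc))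
      (card_erase_orderEmbOfFin hs j.castSucc) (faceRes (Finset.erase_subset _ s) f)
    rw [Fin.val_castSucc, pow_succ _ (k + 1)]
    linear_combination ((-1) ^ (j : ℕ) * I) * h5

end Stokes

/-! ### The two Poincaré lemmas on a single simplex -/

section LocalPoincare

variable {V : Type u} [Fintype V] [LinearOrder V] {s t : Finset V} {k : ℕ}

/-- The restrictions of the form to all codimension one faces vanish. -/
def VanishesOnBoundary (f : LocalForm s k) : Prop :=
  ∀ j ∈ s, ∀ x ∈ closedSimplex (s.erase j), faceRes (Finset.erase_subset j s) f x = 0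

theorem eq_zero_of_faceRes_zero_form (h : t ⊆ s) {f : LocalForm s 0} {x : EuclideanSpace ℝ V}
    (hf : faceRes h f x = 0) : f x = 0 := by
  ext w
  have h1 := DFunLike.congr_fun hf (fun j => j.elim0)
  refine Eq.trans ?_ h1
  exact congrArg (f x) (Subsingleton.elim _ _)

theorem faceRes_congr (h : t ⊆ s) {f g : LocalForm s k} {x : EuclideanSpace ℝ V}
    (hfg : f x = g x) : faceRes h f x = faceRes h g x := by
  simp only [faceRes, hfg]

/-- A facet opposite to `j ≠ q` contains the apex, so there the cone is the cone of the restricted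
form, which is zero. -/
theorem faceRes_coneOp_apex_eq_zero {q : V} (hq : q ∈ s) {f : LocalForm s (k + 1)}
    (hf : IsSmooth f) (hb : VanishesOnBoundary f) {j : V} (hj : j ∈ s) (hjq : j ≠ q)
    {x : EuclideanSpace ℝ V} (hx : x ∈ closedSimplex (s.erase j)) :
    faceRes (Finset.erase_subset j s) (coneOp (EuclideanSpace.single q 1) f) x = 0 := by
  have hp : EuclideanSpace.single q (1 : ℝ) ∈ closedSimplex (s.erase j) :=
    single_mem_closedSimplex (Finset.mem_erase.2 ⟨hjq.symm, hq⟩)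
  rw [faceRes_coneOp _ hp hf hx]
  exact coneOp_eq_zero hp (hb j hj) hx

/-- A closed `0`-form that vanishes at a point of the simplex is zero. -/
theorem eq_zero_of_extD_eq_zero {f : LocalForm s 0} (hf : IsSmooth f)
    (hd : ∀ x ∈ closedSimplex s, extD f x = 0) {p x : EuclideanSpace ℝ V}
    (hp : p ∈ closedSimplex s) (hfp : f p = 0) (hx : x ∈ closedSimplex s) : f x = 0 := by
  have h := coneOp_extD_zero hp hf hx
  rw [coneOp_eq_zero hp hd hx, hfp, sub_zero] at h
  exact h.symm

/-- A closed function is constant, so one zero suffices: in positive dimension every vertex lies on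
some facet, and on a point the integral is the value. -/
theorem closed_zero_form_eq_zero {n : ℕ} (hs : s.card = n + 1) {f : LocalForm s 0}
    (hf : IsSmooth f) (hd : ∀ x ∈ closedSimplex s, extD f x = 0) (hb : VanishesOnBoundary f)
    (hint : ∀ h : s.card = 1, simplexIntegral s h f = 0) {x : EuclideanSpace ℝ V}
    (hx : x ∈ closedSimplex s) : f x = 0 := by
  have hmem := s.orderEmbOfFin_mem hs 0
  refine eq_zero_of_extD_eq_zero hf hd (single_mem_closedSimplex hmem) ?_ hx
  rcases Nat.eq_zero_or_pos n with rfl | hn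
  · ext w
    rw [← simplexIntegral_zero_form hs f w, hint hs]
    rfl
  · obtain ⟨j, hj, hne⟩ := Finset.exists_mem_ne (s := s) (by omega) (s.orderEmbOfFin hs 0)
    exact eq_zero_of_faceRes_zero_form (Finset.erase_subset j s)
      (hb j hj _ (single_mem_closedSimplex (Finset.mem_erase.2 ⟨hne.symm, hmem⟩)))

/-- Coning from a vertex `q` leaves an error only on the opposite facet, where the cone satisfies
the hypotheses of the same problem one dimension and one degree lower. A primitive of that error is
extended inside and its differential subtracted, which does not change the derivative. -/
theorem exists_relative_primitive (n : ℕ) : ∀ (s : Finset V), s.card = n + 1 → ∀ k : ℕ,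
    k + 1 ≤ n → ∃ C : ℝ, 0 ≤ C ∧ ∀ f : LocalForm s (k + 1), IsSmooth f →
      (∀ x ∈ closedSimplex s, extD f x = 0) → VanishesOnBoundary f →
      (∀ h : s.card = k + 2, simplexIntegral s h f = 0) →
      ∃ g : LocalForm s k, IsSmooth g ∧ VanishesOnBoundary g ∧
        (∀ x ∈ closedSimplex s, extD g x = f x) ∧
        ∀ M : ℝ, (∀ x ∈ closedSimplex s, ‖f x‖ ≤ M) → ∀ x ∈ closedSimplex s, ‖g x‖ ≤ C * M := by
  induction n with
  | zero => intro s hs k hk; omega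
  | succ n ih =>
    intro s hs k hk
    set q := lastVertex s hs with hq
    have hqs : q ∈ s := s.orderEmbOfFin_mem hs _
    have hF : (s.erase q).card = n + 1 := card_erase_orderEmbOfFin hs _
    have hFs : s.erase q ⊆ s := Finset.erase_subset q s
    have hp : EuclideanSpace.single q (1 : ℝ) ∈ closedSimplex s := single_mem_closedSimplex hqs
    have hcone : ∀ f : LocalForm s (k + 1), IsSmooth f →
        (∀ x ∈ closedSimplex s, extD f x = 0) → VanishesOnBoundary f →
        (∀ h : s.card = k + 2, simplexIntegral s h f = 0) →
        (∀ x ∈ closedSimplex s, extD (coneOp (EuclideanSpace.single q 1) f) x = f x) ∧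
        (∀ x ∈ closedSimplex (s.erase q),
          extD (faceRes hFs (coneOp (EuclideanSpace.single q 1) f)) x = 0) ∧
        VanishesOnBoundary (faceRes hFs (coneOp (EuclideanSpace.single q 1) f)) ∧
        ∀ h : (s.erase q).card = k + 1,
          simplexIntegral (s.erase q) h
            (faceRes hFs (coneOp (EuclideanSpace.single q 1) f)) = 0 := by
      intro f hf hd hb hint
      have hdc : ∀ x ∈ closedSimplex s,
          extD (coneOp (EuclideanSpace.single q 1) f) x = f x := fun x hx => by
        have h := extD_coneOp hp hf hx
        rwa [coneOp_eq_zero hp hd hx, add_zero] at h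
      refine ⟨hdc, fun x hx => ?_, fun j hj x hx => ?_, fun h => ?_⟩
      · rw [extD_faceRes hFs (hf.coneOp hp) hx,
          faceRes_congr hFs (hdc x (closedSimplex_mono hFs hx))]
        exact hb q hqs x hx
      · have hj' := Finset.mem_erase.1 hj
        have hsub : (s.erase q).erase j ⊆ s.erase j := Finset.erase_subset_erase j hFs
        have h1 := faceRes_coneOp_apex_eq_zero hqs hf hb hj'.2 hj'.1 (closedSimplex_mono hsub hx)
        exact faceRes_apply_eq_zero hsub h1
      -- The integral condition passes to the facet because the two integrals agree up to sign.
      · have hsk : s.card = k + 2 := by omega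
        obtain rfl : n = k := by omega
        have h1 := simplexIntegral_eq_coneOp hs h hf
        rw [hint hs] at h1
        exact (mul_eq_zero.1 h1.symm).resolve_left (by positivity)
    cases k with
    | zero =>
      refine ⟨2, by norm_num, fun f hf hd hb hint => ?_⟩
      obtain ⟨h1, h2, h3, h4⟩ := hcone f hf hd hb hint
      refine ⟨coneOp (EuclideanSpace.single q 1) f, hf.coneOp hp, fun j hj x hx => ?_, h1,
        fun M hM x hx => norm_coneOp_le hp hM hx⟩
      by_cases hjq : j = q
      · subst hjq
        exact closed_zero_form_eq_zero hF ((hf.coneOp hp).faceRes _) h2 h3 h4 hx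
      · exact faceRes_coneOp_apex_eq_zero hqs hf hb hj hjq hx
    | succ k =>
      obtain ⟨C₁, hC₁, hprim⟩ := ih (s.erase q) hF k (by omega)
      obtain ⟨C₂, hC₂, hext⟩ := exists_norm_extOp_le s q k
      -- The cone costs `2 * M`; the inductive primitive `γ` is bounded by `C₁ * (2 * M)`, and its
      -- derivative, being the restricted cone, by `2 * M`.
      refine ⟨2 + C₂ * (C₁ * 2 + 2), by positivity, fun f hf hd hb hint => ?_⟩
      obtain ⟨h1, h2, h3, h4⟩ := hcone f hf hd hb hint
      obtain ⟨γ, hγ, hγb, hγd, hγM⟩ := hprim _ ((hf.coneOp hp).faceRes hFs) h2 h3 h4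
      have hes : IsSmooth (extOp (s := s) q γ) := hγ.extOp
      refine ⟨coneOp (EuclideanSpace.single q 1) f - extD (extOp q γ),
        (hf.coneOp hp).sub hes.extD, fun j hj x hx => ?_, fun x hx => ?_, fun M hM x hx => ?_⟩
      · rw [faceRes_sub, Pi.sub_apply, ← extD_faceRes _ hes hx]
        by_cases hjq : j = q
        · subst hjq
          rw [extD_congr (g := γ) (fun y hy => faceRes_extOp_self _ γ hy) hx, hγd x hx, sub_self]
        · rw [faceRes_coneOp_apex_eq_zero hqs hf hb hj hjq hx, zero_sub, neg_eq_zero]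
          refine extD_eq_zero (fun y hy => faceRes_extOp_eq_zero _ (fun z hz => ?_) hy) hx
          have hset : (s.erase j).erase q = (s.erase q).erase j := Finset.erase_right_comm
          have hz' : z ∈ closedSimplex ((s.erase q).erase j) := hset ▸ hz
          exact faceRes_apply_eq_zero (t := (s.erase j).erase q) hset.subset
            (hγb j (Finset.mem_erase.2 ⟨hjq, hj⟩) z hz')
      · rw [extD_sub (hf.coneOp hp) hes.extD hx, h1 x hx, extD_extD hes hx, sub_zero]
      · have hM0 : 0 ≤ M := (norm_nonneg (f x)).trans (hM x hx)
        have hcM : ∀ y ∈ closedSimplex s,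
            ‖coneOp (EuclideanSpace.single q 1) f y‖ ≤ 2 * M := fun y hy => norm_coneOp_le hp hM hy
        have hbM : ∀ y ∈ closedSimplex (s.erase q),
            ‖faceRes hFs (coneOp (EuclideanSpace.single q 1) f) y‖ ≤ 2 * M := fun y hy =>
          (norm_faceRes_le hFs _ y).trans (hcM y (closedSimplex_mono hFs hy))
        have h5 := (hext γ hγ (C₁ * (2 * M)) (2 * M) (by positivity) (by positivity)
          (hγM _ hbM) (fun y hy => by rw [hγd y hy]; exact hbM y hy) x hx).2
        refine (norm_sub_le (coneOp (EuclideanSpace.single q 1) f x) _).trans ?_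
        calc _ ≤ 2 * M + C₂ * (C₁ * (2 * M) + 2 * M) := add_le_add (hcM x hx) h5
          _ = _ := by ring

/-- A family of forms on the codimension one faces, smooth and agreeing on common faces. -/
structure IsBoundaryForm (b : ∀ j : V, LocalForm (s.erase j) k) : Prop where
  smooth : ∀ j ∈ s, IsSmooth (b j)
  compatible : ∀ i ∈ s, ∀ j ∈ s, ∀ (t : Finset V) (hi : t ⊆ s.erase i) (hj : t ⊆ s.erase j),
    ∀ x ∈ closedSimplex t, faceRes hi (b i) x = faceRes hj (b j) x

/-- Facets are treated one at a time: to the extension `e` so far is added the extension of the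
defect of `e` on the new facet. By compatibility the defect vanishes where the new facet meets the
old ones, so earlier boundary values survive. -/
theorem exists_partial_extension (s : Finset V) (k : ℕ) (R : Finset V) : R ⊆ s →
    ∃ C : ℝ, 0 ≤ C ∧ ∀ b : ∀ j : V, LocalForm (s.erase j) k, IsBoundaryForm b →
      ∃ e : LocalForm s k, IsSmooth e ∧
        (∀ j ∈ R, ∀ x ∈ closedSimplex (s.erase j),
          faceRes (Finset.erase_subset j s) e x = b j x) ∧
        ∀ M M' : ℝ, 0 ≤ M → 0 ≤ M' →
          (∀ j ∈ s, ∀ x ∈ closedSimplex (s.erase j), ‖b j x‖ ≤ M) →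
          (∀ j ∈ s, ∀ x ∈ closedSimplex (s.erase j), ‖extD (b j) x‖ ≤ M') →
          ∀ x ∈ closedSimplex s, ‖e x‖ ≤ C * M ∧ ‖extD e x‖ ≤ C * (M + M') := by
  induction R using Finset.induction_on with
  | empty =>
    intro _
    refine ⟨0, le_rfl, fun b _ => ⟨0, IsSmooth.zero, by simp, fun M M' _ _ _ _ x _ => ?_⟩⟩
    rw [extD_zero, zero_mul, zero_mul]
    exact ⟨(norm_zero (E := simplexDir s [⋀^Fin k]→L[ℝ] ℝ)).le,
      (norm_zero (E := simplexDir s [⋀^Fin (k + 1)]→L[ℝ] ℝ)).le⟩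
  | insert i R hiR ih =>
    intro hR
    have his : i ∈ s := hR (Finset.mem_insert_self i R)
    have hRs : R ⊆ s := (Finset.subset_insert i R).trans hR
    have hFs : s.erase i ⊆ s := Finset.erase_subset i s
    obtain ⟨C, hC, hpart⟩ := ih hRs
    obtain ⟨C', hC', hext⟩ := exists_norm_extOp_le s i k
    refine ⟨C + C' * (1 + 2 * C), by positivity, fun b hb => ?_⟩
    obtain ⟨e, he, heb, heM⟩ := hpart b hb
    set c : LocalForm (s.erase i) k := b i - faceRes hFs e with hc
    have hcs : IsSmooth c := (hb.smooth i his).sub (he.faceRes hFs)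
    have hes : IsSmooth (extOp (s := s) i c) := hcs.extOp
    refine ⟨e + extOp i c, he.add hes, fun j hj x hx => ?_, fun M M' hM0 hM0' hM hM' x hx => ?_⟩
    · rw [faceRes_add, Pi.add_apply]
      rcases Finset.mem_insert.1 hj with rfl | hjR
      · rw [faceRes_extOp_self _ c hx, hc, Pi.sub_apply]
        abel
      · rw [faceRes_extOp_eq_zero (Finset.erase_subset j s) (fun y hy => ?_) hx, add_zero,
          heb j hjR x hx]
        have hi' : (s.erase j).erase i ⊆ s.erase i :=
          Finset.erase_subset_erase i (Finset.erase_subset j s)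
        have hj' : (s.erase j).erase i ⊆ s.erase j := Finset.erase_subset i _
        rw [hc, faceRes_sub, Pi.sub_apply, hb.compatible i his j (hRs hjR) _ hi' hj' y hy,
          faceRes_faceRes, ← faceRes_faceRes (Finset.erase_subset j s) hj',
          faceRes_congr hj' (heb j hjR y (closedSimplex_mono hj' hy)), sub_self]
    · have heM := heM M M' hM0 hM0' hM hM'
      have hcM : ∀ y ∈ closedSimplex (s.erase i), ‖c y‖ ≤ M + C * M := fun y hy =>
        (norm_sub_le (b i y) _).trans (add_le_add (hM i his y hy)
          ((norm_faceRes_le hFs e y).trans (heM y (closedSimplex_mono hFs hy)).1))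
      have hcM' : ∀ y ∈ closedSimplex (s.erase i), ‖extD c y‖ ≤ M' + C * (M + M') := by
        intro y hy
        rw [hc, extD_sub (hb.smooth i his) (he.faceRes hFs) hy, extD_faceRes hFs he hy]
        exact (norm_sub_le (extD (b i) y) _).trans (add_le_add (hM' i his y hy)
          ((norm_faceRes_le hFs _ y).trans (heM y (closedSimplex_mono hFs hy)).2))
      obtain ⟨h1, h2⟩ := hext c hcs _ _ (by positivity) (by positivity) hcM hcM' x hx
      constructor
      · refine (norm_add_le (e x) _).trans ?_
        refine (add_le_add (heM x hx).1 h1).trans ?_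
        have : 0 ≤ C' * (C * M) := by positivity
        linarith
      · rw [extD_add he hes hx]
        refine (norm_add_le (extD e x) _).trans ?_
        refine (add_le_add (heM x hx).2 h2).trans ?_
        have : 0 ≤ C' * (C * M') := by positivity
        linarith

/-- For an extension `e` of the boundary data, `f - de` is closed and vanishes on the boundary; in
top degree its integral vanishes by Stokes. The relative lemma supplies the remaining part of the
primitive. -/
theorem exists_primitive_extending {n : ℕ} (hs : s.card = n + 1) (hk : k + 1 ≤ n) :
    ∃ C : ℝ, 0 ≤ C ∧ ∀ (f : LocalForm s (k + 1)) (b : ∀ j : V, LocalForm (s.erase j) k),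
      IsSmooth f → (∀ x ∈ closedSimplex s, extD f x = 0) → IsBoundaryForm b →
      (∀ j ∈ s, ∀ x ∈ closedSimplex (s.erase j),
        extD (b j) x = faceRes (Finset.erase_subset j s) f x) →
      (∀ h : s.card = k + 2, simplexIntegral s h f = ∑ i : Fin (k + 2), (-1) ^ (i : ℕ) *
        simplexIntegral (s.erase (s.orderEmbOfFin h i)) (card_erase_orderEmbOfFin h i)
          (b (s.orderEmbOfFin h i))) →
      ∃ g : LocalForm s k, IsSmooth g ∧
        (∀ j ∈ s, ∀ x ∈ closedSimplex (s.erase j),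
          faceRes (Finset.erase_subset j s) g x = b j x) ∧
        (∀ x ∈ closedSimplex s, extD g x = f x) ∧
        ∀ M : ℝ, (∀ x ∈ closedSimplex s, ‖f x‖ ≤ M) →
          (∀ j ∈ s, ∀ x ∈ closedSimplex (s.erase j), ‖b j x‖ ≤ M) →
          ∀ x ∈ closedSimplex s, ‖g x‖ ≤ C * M := by
  obtain ⟨C₁, hC₁, hprim⟩ := exists_relative_primitive n s hs k hk
  obtain ⟨C₂, hC₂, hext⟩ := exists_partial_extension s k s subset_rfl
  refine ⟨C₂ + C₁ * (1 + 2 * C₂), by positivity, fun f b hf hd hb hbd hint => ?_⟩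
  obtain ⟨e, he, heb, heM⟩ := hext b hb
  obtain ⟨g, hg, hgb, hgd, hgM⟩ := hprim (f - extD e) (hf.sub he.extD)
    (fun x hx => by rw [extD_sub hf he.extD hx, hd x hx, extD_extD he hx, sub_zero])
    (fun j hj x hx => by
      rw [faceRes_sub, Pi.sub_apply, ← extD_faceRes _ he hx, ← hbd j hj x hx,
        extD_congr (heb j hj) hx, sub_self])
    (fun h => by
      rw [simplexIntegral_sub h hf he.extD, hint h, simplexIntegral_extD h he, sub_eq_zero]
      refine Finset.sum_congr rfl fun i _ => ?_
      rw [simplexIntegral_congr _ (heb _ (s.orderEmbOfFin_mem h i))])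
  refine ⟨e + g, he.add hg, fun j hj x hx => ?_, fun x hx => ?_, fun M hfM hbM x hx => ?_⟩
  · rw [faceRes_add, Pi.add_apply, heb j hj x hx, hgb j hj x hx, add_zero]
  · rw [extD_add he hg hx, hgd x hx, Pi.sub_apply]
    abel
  · have hM0 : 0 ≤ M := (norm_nonneg (f x)).trans (hfM x hx)
    have heM := heM M M hM0 hM0 hbM fun j hj y hy => by
      rw [hbd j hj y hy]
      exact (norm_faceRes_le _ f y).trans
        (hfM y (closedSimplex_mono (Finset.erase_subset j s) hy))
    have h1 := hgM (M + C₂ * (M + M)) (fun y hy =>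
      (norm_sub_le (f y) _).trans (add_le_add (hfM y hy) (heM y hy).2)) x hx
    refine (norm_add_le (e x) _).trans ((add_le_add (heM x hx).1 h1).trans (le_of_eq ?_))
    ring

end LocalPoincare

/-! ### Compatible families of forms on a complex -/

section Families

variable {V : Type u} [Fintype V] [DecidableEq V] {X A : PreAbstractSimplicialComplex V} {k : ℕ}

/-- The families of forms on the simplices of `X`, smooth and compatible with restriction to
faces, that vanish on `A`. -/
def relForms (X A : PreAbstractSimplicialComplex V) (k : ℕ) :
    Submodule ℝ (∀ s : Finset V, LocalForm s k) where
  carrier := {f | (∀ s ∈ X.faces, IsSmooth (f s)) ∧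
    (∀ s ∈ X.faces, ∀ (t : Finset V) (h : t ⊆ s), ∀ x ∈ closedSimplex t,
      faceRes h (f s) x = f t x) ∧
    ∀ s ∈ A.faces, ∀ x ∈ closedSimplex s, f s x = 0}
  add_mem' := by
    rintro f g ⟨hf, hf', hf''⟩ ⟨hg, hg', hg''⟩
    refine ⟨fun s hs => (hf s hs).add (hg s hs), fun s hs t h x hx => ?_, fun s hs x hx => ?_⟩
    · rw [Pi.add_apply, faceRes_add, Pi.add_apply, hf' s hs t h x hx, hg' s hs t h x hx]
      rfl
    · rw [Pi.add_apply, Pi.add_apply, hf'' s hs x hx, hg'' s hs x hx, add_zero]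
  zero_mem' := ⟨fun s _ => IsSmooth.zero, fun s _ t h x _ => faceRes_apply_eq_zero h rfl,
    fun s _ x _ => rfl⟩
  smul_mem' := by
    rintro c f ⟨hf, hf', hf''⟩
    refine ⟨fun s hs => (hf s hs).const_smul c, fun s hs t h x hx => ?_, fun s hs x hx => ?_⟩
    · exact congrArg (c • ·) (hf' s hs t h x hx)
    · rw [Pi.smul_apply, Pi.smul_apply, hf'' s hs x hx, smul_zero]

theorem extD_mem_relForms {f : ∀ s : Finset V, LocalForm s k}
    (hf : f ∈ relForms X A k) : (fun s => extD (f s)) ∈ relForms X A (k + 1) := by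
  refine ⟨fun s hs => (hf.1 s hs).extD, fun s hs t h x hx => ?_, fun s hs x hx => ?_⟩
  · rw [← extD_faceRes h (hf.1 s hs) hx]
    exact extD_congr (hf.2.1 s hs t h) hx
  · exact extD_eq_zero (hf.2.2 s hs) hx

/-- The tangent space has dimension less than `k`: forgetting one coordinate is injective on vectors
of coordinate sum zero. Alternating forms vanish on dependent families. -/
theorem eq_zero_of_card_le {s : Finset V} (f : LocalForm s k) {x : EuclideanSpace ℝ V}
    (hx : x ∈ closedSimplex s) (hs : s.card ≤ k) : f x = 0 := by
  obtain ⟨p, hp⟩ := nonempty_of_mem_closedSimplex hx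
  let φ : simplexDir s →ₗ[ℝ] (s.erase p → ℝ) :=
    { toFun := fun v i => v.1 i
      map_add' := fun v w => rfl
      map_smul' := fun c v => rfl }
  have hφ : Function.Injective φ := by
    rw [injective_iff_map_eq_zero]
    intro v hv
    have h1 : ∀ i, i ≠ p → v.1 i = 0 := fun i hi => by
      by_cases his : i ∈ s
      · exact congrFun hv ⟨i, Finset.mem_erase.2 ⟨hi, his⟩⟩
      · exact v.2.1 i his
    have h2 : v.1 p = 0 := by
      rw [← v.2.2, Finset.sum_eq_single p (fun i _ hi => h1 i hi) (by simp)]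
    ext i
    by_cases hi : i = p
    · rw [hi]; exact h2
    · exact h1 i hi
  have h3 : Module.finrank ℝ (simplexDir s) < k := by
    have h4 := LinearMap.finrank_le_finrank_of_injective hφ
    rw [Module.finrank_fintype_fun_eq_card, Fintype.card_coe, Finset.card_erase_of_mem hp] at h4
    have := Finset.card_pos.2 ⟨p, hp⟩
    omega
  ext w
  refine (f x).toAlternatingMap.map_linearDependent w fun hw => ?_
  have h5 := hw.fintype_card_le_finrank
  rw [Fintype.card_fin] at h5
  omega

namespace SimplexwiseForm

/-- The simplexwise form of a compatible family. -/
def ofMem (f : ∀ s : Finset V, LocalForm s k) (hf : f ∈ relForms X A k) : SimplexwiseForm X k where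
  toFun := f
  smooth := hf.1
  compatible := fun s _ t ht h x hx w => DFunLike.congr_fun (hf.2.1 t ht s h x hx) w

theorem faceRes_toFun (a : SimplexwiseForm X k) {s t : Finset V} (hs : s ∈ X.faces) (h : t ⊆ s)
    {x : EuclideanSpace ℝ V} (hx : x ∈ closedSimplex t) :
    faceRes h (a.toFun s) x = a.toFun t x := by
  ext w
  exact a.compatible t ((X.isRelLowerSet_faces hs).2 h (nonempty_of_mem_closedSimplex hx))
    s hs h x hx w

theorem toFun_mem_relForms (a : SimplexwiseForm X k) {hAX : A ≤ X} (ha : (a.restrict hAX).IsZero) :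
    a.toFun ∈ relForms X A k :=
  ⟨a.smooth, fun _ hs _ h _ hx => a.faceRes_toFun hs h hx, ha⟩

theorem isPrimitiveOf_iff {a : SimplexwiseForm X k} {b : SimplexwiseForm X (k + 1)} :
    a.IsPrimitiveOf b ↔
      ∀ s ∈ X.faces, ∀ x ∈ closedSimplex s, extD (a.toFun s) x = b.toFun s x := by
  refine ⟨fun h s hs x hx => ?_, fun h s hs v hv => ?_⟩
  · exact (h s hs _ (unchart_mem hx)).trans (by rw [chart_unchart hx])
  · rw [← h s hs _ hv, extD, unchart_chart]
    rfl

theorem isClosedForm_iff {a : SimplexwiseForm X k} :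
    a.IsClosedForm ↔ ∀ s ∈ X.faces, ∀ x ∈ closedSimplex s, extD (a.toFun s) x = 0 := by
  refine ⟨fun h s hs x hx => h s hs _ (unchart_mem hx), fun h s hs v hv => ?_⟩
  rw [← h s hs _ hv, extD, unchart_chart]
  rfl

theorem norm_le_toReal (a : SimplexwiseForm X k) {N : ℝ≥0∞} (hN : N ≠ ⊤) (h : a.supNorm ≤ N)
    {s : Finset V} (hs : s ∈ X.faces) {x : EuclideanSpace ℝ V} (hx : x ∈ closedSimplex s) :
    ‖a.toFun s x‖ ≤ N.toReal := by
  have h1 : ‖a.toFun s x‖ₑ ≤ N := le_trans (le_trans (le_iSup₂ (f := fun y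
    (_ : y ∈ closedSimplex s) => ‖a.toFun s y‖ₑ) x hx) (le_iSup₂ (f := fun t
    (_ : t ∈ X.faces) => ⨆ y ∈ closedSimplex t, ‖a.toFun t y‖ₑ) s hs)) h
  have h2 := ENNReal.toReal_mono hN h1
  rwa [toReal_enorm] at h2

theorem supNorm_le (a : SimplexwiseForm X k) {N : ℝ≥0∞} {C : ℝ} (hC : 0 ≤ C)
    (h : N ≠ ⊤ → ∀ s ∈ X.faces, ∀ x ∈ closedSimplex s, ‖a.toFun s x‖ ≤ C * N.toReal) :
    -- The added `1` keeps the constant nonzero, so the right side is `⊤` when `N = ⊤`.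
    a.supNorm ≤ ((C.toNNReal + 1 : ℝ≥0) : ℝ≥0∞) * N := by
  by_cases hN : N = ⊤
  · rw [hN, ENNReal.mul_top (by simp)]
    exact le_top
  · refine iSup₂_le fun s hs => iSup₂_le fun x hx => ?_
    have h1 := h hN s hs x hx
    rw [← ofReal_norm]
    calc ENNReal.ofReal ‖a.toFun s x‖ ≤ ENNReal.ofReal (C * N.toReal) := ENNReal.ofReal_le_ofReal h1
      _ = ENNReal.ofReal C * N := by rw [ENNReal.ofReal_mul hC, ENNReal.ofReal_toReal hN]
      _ ≤ _ := by
        gcongr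
        exact ENNReal.coe_le_coe.2 (le_add_of_nonneg_right zero_le_one)

end SimplexwiseForm

end Families

/-! ### The Poincaré lemmas for the standard simplex -/

section StandardSimplex

theorem exists_primitive_extending_stdComplex (n k : ℕ) (hk : k + 1 ≤ n) :
    ∃ C : ℝ≥0, ∀ (η : SimplexwiseForm (stdComplex n) (k + 1))
      (b : SimplexwiseForm (bdryComplex n) k),
      η.IsClosedForm → b.IsPrimitiveOf (η.restrict (bdryComplex_le n)) →
      (∀ h : k + 1 = n, stdIntegral η h = bdryIntegral b h) →
      ∃ a : SimplexwiseForm (stdComplex n) k,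
        (a.restrict (bdryComplex_le n)).Agrees b ∧ a.IsPrimitiveOf η ∧
        a.supNorm ≤ C * (η.supNorm + b.supNorm) := by
  obtain ⟨C, hC, hext⟩ := exists_primitive_extending (V := Fin (n + 1)) (s := Finset.univ)
    (by simp) hk
  refine ⟨C.toNNReal + 1, fun η b hη hb hint => ?_⟩
  have huniv : (Finset.univ : Finset (Fin (n + 1))) ∈ (stdComplex n).faces :=
    Finset.univ_nonempty
  have herase : ∀ j, (Finset.univ : Finset (Fin (n + 1))).erase j ∈ (bdryComplex n).faces := by
    refine fun j => ⟨?_, fun h => ?_⟩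
    · rw [← Finset.card_pos, Finset.card_erase_of_mem (Finset.mem_univ j), Finset.card_fin]
      omega
    · exact Finset.notMem_erase j Finset.univ (h.symm.subset (Finset.mem_univ j))
  rw [SimplexwiseForm.isPrimitiveOf_iff] at hb
  rw [SimplexwiseForm.isClosedForm_iff] at hη
  obtain ⟨g, hg, hgb, hgd, hgM⟩ := hext (η.toFun Finset.univ)
    (fun j => b.toFun (Finset.univ.erase j)) (η.smooth _ huniv) (hη _ huniv)
    ⟨fun j _ => b.smooth _ (herase j), fun i _ j _ t hi hj x hx => by
      rw [b.faceRes_toFun (herase i) hi hx, b.faceRes_toFun (herase j) hj hx]⟩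
    (fun j _ x hx => by
      rw [hb _ (herase j) x hx, η.faceRes_toFun huniv _ hx]
      rfl)
    (fun h => by
      have hn : k + 1 = n := by simpa using h.symm
      subst hn
      refine (hint rfl).trans (Finset.sum_congr rfl fun i _ => ?_)
      -- The increasing enumeration of all vertices is the identity, so the boundary integral agrees
      -- with the sum in Stokes' theorem.
      have hi : Finset.univ.orderEmbOfFin h i = i :=
        (congrFun (Finset.orderEmbOfFin_unique h (f := id) (fun _ => Finset.mem_univ _)
          strictMono_id) i).symm
      have hcongr : ∀ (j : Fin (k + 1 + 1)) (hj : (Finset.univ.erase j).card = k + 1)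
          (hi' : (Finset.univ.erase i).card = k + 1), j = i →
          simplexIntegral (Finset.univ.erase j) hj (b.toFun (Finset.univ.erase j)) =
            simplexIntegral (Finset.univ.erase i) hi' (b.toFun (Finset.univ.erase i)) := by
        rintro j hj hi' rfl
        rfl
      rw [hcongr _ _ (by simp) hi]
      rfl)
  have hmem : (fun t => faceRes (Finset.subset_univ t) g) ∈ relForms (stdComplex n) ⊥ k :=
    ⟨fun t _ => hg.faceRes _, fun s _ t h x _ => rfl, fun s hs => hs.elim⟩
  refine ⟨SimplexwiseForm.ofMem _ hmem, fun t ht x hx => ?_,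
    SimplexwiseForm.isPrimitiveOf_iff.2 fun t ht x hx => ?_,
    SimplexwiseForm.supNorm_le _ hC fun hN t ht x hx => ?_⟩
  · obtain ⟨j, hj⟩ : ∃ j, j ∉ t := by
      by_contra! h
      exact ht.2 (Finset.eq_univ_iff_forall.2 h)
    have htj : t ⊆ Finset.univ.erase j := fun i hi =>
      Finset.mem_erase.2 ⟨fun h => hj (h ▸ hi), Finset.mem_univ i⟩
    rw [← b.faceRes_toFun (herase j) htj hx]
    exact faceRes_congr htj (hgb j (Finset.mem_univ j) x (closedSimplex_mono htj hx))
  · rw [← η.faceRes_toFun huniv (Finset.subset_univ t) hx]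
    refine (extD_faceRes _ hg hx).trans (faceRes_congr _ ?_)
    exact hgd x (closedSimplex_mono (Finset.subset_univ t) hx)
  · refine (norm_faceRes_le _ g x).trans (hgM _ (fun y hy => ?_) (fun j _ y hy => ?_) x
      (closedSimplex_mono (Finset.subset_univ t) hx))
    · exact η.norm_le_toReal hN le_self_add huniv hy
    · exact b.norm_le_toReal hN le_add_self (herase j) hy

theorem exists_primitive_vanishing_on_bdryComplex (n k : ℕ) (hk : k + 1 ≤ n) :
    ∃ C : ℝ≥0, ∀ η : SimplexwiseForm (stdComplex n) (k + 1),
      η.IsClosedForm → (η.restrict (bdryComplex_le n)).IsZero →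
      (∀ h : k + 1 = n, stdIntegral η h = 0) →
      ∃ a : SimplexwiseForm (stdComplex n) k,
        (a.restrict (bdryComplex_le n)).IsZero ∧ a.IsPrimitiveOf η ∧
        a.supNorm ≤ C * η.supNorm := by
  obtain ⟨C, hC⟩ := exists_primitive_extending_stdComplex n k hk
  refine ⟨C, fun η hη hη0 hint => ?_⟩
  let b : SimplexwiseForm (bdryComplex n) k :=
    SimplexwiseForm.ofMem (A := ⊥) 0 (Submodule.zero_mem _)
  have hb : b.supNorm = 0 := by
    simp only [SimplexwiseForm.supNorm, ENNReal.iSup_eq_zero]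
    intro s _ x _
    have h0 : ‖b.toFun s x‖ = 0 := norm_zero (E := simplexDir s [⋀^Fin k]→L[ℝ] ℝ)
    rw [← ofReal_norm, h0, ENNReal.ofReal_zero]
  obtain ⟨a, ha, had, haM⟩ := hC η b hη
    (SimplexwiseForm.isPrimitiveOf_iff.2 fun s hs x hx => by
      rw [hη0 s hs x hx]
      exact extD_zero x)
    (fun h => by
      rw [hint h]
      simp [bdryIntegral, SimplexwiseForm.integral, b, SimplexwiseForm.ofMem])
  rw [hb, add_zero] at haM
  exact ⟨a, ha, had, haM⟩

end StandardSimplex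

/-! ### Linear sections and uniform bounds in finite dimension -/

section Bounds

open MeasureTheory

/-- A linear right inverse on the range, extended to the whole target. No topology on the space of
forms is involved. -/
theorem exists_linear_generalizedInverse {E F : Type*} [AddCommGroup E] [Module ℝ E]
    [AddCommGroup F] [Module ℝ F] (φ : E →ₗ[ℝ] F) : ∃ σ : F →ₗ[ℝ] E, ∀ v, φ (σ (φ v)) = φ v := by
  obtain ⟨σ, hσ⟩ := φ.rangeRestrict.exists_rightInverse_of_surjective φ.range_rangeRestrict
  obtain ⟨τ, hτ⟩ := σ.exists_extend
  refine ⟨τ, fun v => ?_⟩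
  have h1 : τ (φ v) = σ (φ.rangeRestrict v) := LinearMap.congr_fun hτ (φ.rangeRestrict v)
  rw [h1]
  exact congrArg Subtype.val (LinearMap.congr_fun hσ (φ.rangeRestrict v))

theorem exists_uniform_bound_of_finiteDimensional {E F ι : Type*} [NormedAddCommGroup E]
    [NormedSpace ℝ E] [FiniteDimensional ℝ E] [NormedAddCommGroup F] [NormedSpace ℝ F]
    (L : ι → E →ₗ[ℝ] F) (h : ∀ v, ∃ C, ∀ i, ‖L i v‖ ≤ C) :
    ∃ C : ℝ, 0 ≤ C ∧ ∀ i v, ‖L i v‖ ≤ C * ‖v‖ := by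
  have : CompleteSpace E := FiniteDimensional.complete ℝ E
  obtain ⟨C, hC⟩ := banach_steinhaus (g := fun i => LinearMap.toContinuousLinearMap (L i)) h
  refine ⟨max C 0, le_max_right _ _, fun i v => ?_⟩
  exact (LinearMap.toContinuousLinearMap (L i)).le_of_opNorm_le ((hC i).trans (le_max_left _ _)) v

variable {V : Type u} [Fintype V] [LinearOrder V] {s t : Finset V} {k : ℕ}

theorem exists_abs_simplexIntegral_le (s : Finset V) (hs : s.card = k + 1) :
    ∃ C : ℝ, 0 ≤ C ∧ ∀ (f : LocalForm s k) (M : ℝ), (∀ x ∈ closedSimplex s, ‖f x‖ ≤ M) →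
      |simplexIntegral s hs f| ≤ C * M := by
  refine ⟨(∏ j, ‖edges s hs j‖) * volume.real (coordSimplex k), by positivity,
    fun f M hM => ?_⟩
  have h1 := norm_setIntegral_le_of_norm_le_const (μ := volume)
    (isCompact_coordSimplex k).measure_lt_top
    (f := fun y => f (simplexPt s hs y) (edges s hs)) (C := M * ∏ j, ‖edges s hs j‖) fun y hy =>
      ((f (simplexPt s hs y)).le_opNorm _).trans
        (mul_le_mul_of_nonneg_right (hM _ (simplexPt_mem hs hy)) (by positivity))
  rw [← Real.norm_eq_abs]
  exact h1.trans (le_of_eq (by ring))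

end Bounds

/-! ### Bounded relative primitives on a finite simplicial pair -/

section Pairs

variable {V : Type u} [Fintype V] [LinearOrder V] {X A : PreAbstractSimplicialComplex V} {k : ℕ}

open scoped Classical in
/-- The integrals of the derivative of a `k`-form over the `(k + 1)`-simplices of `X`. -/
def periods (X A : PreAbstractSimplicialComplex V) (k : ℕ) :
    relForms X A k →ₗ[ℝ] (Finset V → ℝ) where
  toFun f s := if h : s ∈ X.faces ∧ s.card = k + 2 then simplexIntegral s h.2 (extD (f.1 s)) else 0
  map_add' f g := by
    ext s
    by_cases h : s ∈ X.faces ∧ s.card = k + 2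
    · simp only [Pi.add_apply, dif_pos h]
      rw [← simplexIntegral_add h.2 (f.2.1 s h.1).extD (g.2.1 s h.1).extD]
      exact simplexIntegral_congr h.2 fun x hx => extD_add (f.2.1 s h.1) (g.2.1 s h.1) hx
    · simp only [Pi.add_apply, dif_neg h, add_zero]
  map_smul' c f := by
    ext s
    by_cases h : s ∈ X.faces ∧ s.card = k + 2
    · simp only [Pi.smul_apply, dif_pos h, RingHom.id_apply, smul_eq_mul]
      rw [← simplexIntegral_const_smul h.2]
      exact simplexIntegral_congr h.2 fun x hx => extD_const_smul c hx
    · simp only [Pi.smul_apply, dif_neg h, smul_zero]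

theorem periods_apply (f : relForms X A k) {s : Finset V} (hs : s ∈ X.faces)
    (hc : s.card = k + 2) : periods X A k f s = simplexIntegral s hc (extD (f.1 s)) :=
  dif_pos ⟨hs, hc⟩

theorem exists_norm_periods_le (X A : PreAbstractSimplicialComplex V) (k : ℕ) :
    ∃ C : ℝ, 0 ≤ C ∧ ∀ (f : relForms X A k) (M : ℝ), 0 ≤ M →
      (∀ s ∈ X.faces, ∀ x ∈ closedSimplex s, ‖extD (f.1 s) x‖ ≤ M) →
      ‖periods X A k f‖ ≤ C * M := by
  have h1 : ∀ s : Finset V, ∃ C : ℝ, 0 ≤ C ∧ ∀ (f : relForms X A k) (M : ℝ), 0 ≤ M →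
      (∀ s ∈ X.faces, ∀ x ∈ closedSimplex s, ‖extD (f.1 s) x‖ ≤ M) →
      ‖periods X A k f s‖ ≤ C * M := by
    intro s
    by_cases h : s ∈ X.faces ∧ s.card = k + 2
    · obtain ⟨C, hC, hb⟩ := exists_abs_simplexIntegral_le s h.2
      refine ⟨C, hC, fun f M _ hM => ?_⟩
      rw [periods_apply f h.1 h.2]
      exact hb _ M (hM s h.1)
    · refine ⟨0, le_rfl, fun f M _ _ => ?_⟩
      have h2 : periods X A k f s = 0 := dif_neg h
      rw [h2, norm_zero, zero_mul]
  choose C hC hb using h1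
  refine ⟨∑ s, C s, Finset.sum_nonneg fun s _ => hC s, fun f M hM0 hM => ?_⟩
  refine (pi_norm_le_iff_of_nonneg (mul_nonneg (Finset.sum_nonneg fun s _ => hC s) hM0)).2
    fun s => (hb s f M hM0 hM).trans (mul_le_mul_of_nonneg_right ?_ hM0)
  exact Finset.single_le_sum (fun t _ => hC t) (Finset.mem_univ s)

theorem exists_norm_le_of_isSmooth {s : Finset V} {f : LocalForm s k} (hf : IsSmooth f) :
    ∃ C, ∀ x : closedSimplex s, ‖f x‖ ≤ C := by
  obtain ⟨C, hC⟩ := IsCompact.exists_bound_of_continuousOn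
    (E := simplexDir s [⋀^Fin k]→L[ℝ] ℝ) (f := f) (isCompact_closedSimplex s) hf.continuousOn
  exact ⟨C, fun x => hC x x.2⟩

/-- A section of the period map has finite-dimensional source, and each form in its image is bounded
on every compact simplex together with its derivative. Banach–Steinhaus makes these bounds uniform,
and the periods are bounded by the sup norm of the derivative. -/
theorem exists_bounded_period_correction (X A : PreAbstractSimplicialComplex V) (k : ℕ) :
    ∃ C : ℝ, 0 ≤ C ∧ ∀ f : relForms X A k, ∃ g : relForms X A k,
      periods X A k g = periods X A k f ∧
      ∀ M : ℝ, 0 ≤ M → (∀ s ∈ X.faces, ∀ x ∈ closedSimplex s, ‖extD (f.1 s) x‖ ≤ M) →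
        ∀ s ∈ X.faces, ∀ x ∈ closedSimplex s, ‖g.1 s x‖ ≤ C * M ∧ ‖extD (g.1 s) x‖ ≤ C * M := by
  obtain ⟨C₀, hC₀, hper⟩ := exists_norm_periods_le X A k
  obtain ⟨σ, hσ⟩ := exists_linear_generalizedInverse (E := relForms X A k) (F := Finset V → ℝ)
    (periods X A k)
  have h1 : ∀ s : Finset V, ∃ C : ℝ, 0 ≤ C ∧ (s ∈ X.faces → ∀ (x : closedSimplex s) v,
      ‖(σ v).1 s x‖ ≤ C * ‖v‖ ∧ ‖extD ((σ v).1 s) x‖ ≤ C * ‖v‖) := by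
    intro s
    by_cases hs : s ∈ X.faces
    · let L₁ (x : closedSimplex s) : (Finset V → ℝ) →ₗ[ℝ] simplexDir s [⋀^Fin k]→L[ℝ] ℝ :=
        { toFun := fun v => (σ v).1 s x
          map_add' := fun v w => by rw [map_add]; rfl
          map_smul' := fun c v => by rw [map_smul]; rfl }
      let L₂ (x : closedSimplex s) : (Finset V → ℝ) →ₗ[ℝ] simplexDir s [⋀^Fin (k + 1)]→L[ℝ] ℝ :=
        { toFun := fun v => extD ((σ v).1 s) x
          map_add' := fun v w => by
            rw [map_add]
            exact extD_add ((σ v).2.1 s hs) ((σ w).2.1 s hs) x.2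
          map_smul' := fun c v => by
            rw [map_smul]
            exact extD_const_smul c x.2 }
      obtain ⟨C₁, hC₁, hb₁⟩ := exists_uniform_bound_of_finiteDimensional (E := Finset V → ℝ)
        (F := simplexDir s [⋀^Fin k]→L[ℝ] ℝ) L₁ fun v => exists_norm_le_of_isSmooth ((σ v).2.1 s hs)
      obtain ⟨C₂, hC₂, hb₂⟩ := exists_uniform_bound_of_finiteDimensional (E := Finset V → ℝ)
        (F := simplexDir s [⋀^Fin (k + 1)]→L[ℝ] ℝ) L₂ fun v => exists_norm_le_of_isSmooth ((σ v).2.1 s hs).extD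
      refine ⟨C₁ + C₂, add_nonneg hC₁ hC₂, fun _ x v => ⟨(hb₁ x v).trans ?_, (hb₂ x v).trans ?_⟩⟩
      · exact mul_le_mul_of_nonneg_right (le_add_of_nonneg_right hC₂) (norm_nonneg v)
      · exact mul_le_mul_of_nonneg_right (le_add_of_nonneg_left hC₁) (norm_nonneg v)
    · exact ⟨0, le_rfl, fun h => absurd h hs⟩
  choose C hC hb using h1
  have hC' : 0 ≤ ∑ s, C s := Finset.sum_nonneg fun s _ => hC s
  refine ⟨(∑ s, C s) * C₀, mul_nonneg hC' hC₀, fun f =>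
    ⟨σ (periods X A k f), hσ f, fun M hM0 hM s hs x hx => ?_⟩⟩
  have h2 : C s * ‖periods X A k f‖ ≤ (∑ s, C s) * C₀ * M := by
    rw [mul_assoc]
    exact mul_le_mul (Finset.single_le_sum (fun t _ => hC t) (Finset.mem_univ s))
      (hper f M hM0 hM) (norm_nonneg _) hC'
  exact ⟨(hb s hs ⟨x, hx⟩ _).1.trans h2, (hb s hs ⟨x, hx⟩ _).2.trans h2⟩

/-- A primitive of `f` on the simplices of `X` with at most `m` vertices, vanishing on `A` and on
the `k`-skeleton. -/
structure IsSkeletalPrimitive (X A : PreAbstractSimplicialComplex V) (m : ℕ)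
    (f : ∀ s : Finset V, LocalForm s (k + 1)) (g : ∀ s : Finset V, LocalForm s k) : Prop where
  smooth : ∀ s ∈ X.faces, s.card ≤ m → IsSmooth (g s)
  compatible : ∀ s ∈ X.faces, s.card ≤ m → ∀ (t : Finset V) (h : t ⊆ s), ∀ x ∈ closedSimplex t,
    faceRes h (g s) x = g t x
  primitive : ∀ s ∈ X.faces, s.card ≤ m → ∀ x ∈ closedSimplex s, extD (g s) x = f s x
  vanish : ∀ s ∈ X.faces, s.card ≤ m → s ∈ A.faces ∨ s.card ≤ k + 1 →
    ∀ x ∈ closedSimplex s, g s x = 0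

/-- On `A` and on simplices of dimension at most `k` zero works, the given form being zero there.
Otherwise the second Poincaré lemma applies; on a `(k + 1)`-simplex both sides of its integral
condition are zero, because the boundary data vanish. -/
theorem exists_primitive_on_simplex (X A : PreAbstractSimplicialComplex V) {m : ℕ} {s : Finset V}
    (hs : s ∈ X.faces) (hm : s.card = m + 1) :
    ∃ C : ℝ, 0 ≤ C ∧ ∀ f ∈ relForms X A (k + 1), ∀ g : ∀ s : Finset V, LocalForm s k,
      (∀ x ∈ closedSimplex s, extD (f s) x = 0) →
      (∀ h : s.card = k + 2, simplexIntegral s h (f s) = 0) →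
      IsSkeletalPrimitive X A m f g →
      ∃ e : LocalForm s k, IsSmooth e ∧
        (∀ j ∈ s, ∀ x ∈ closedSimplex (s.erase j),
          faceRes (Finset.erase_subset j s) e x = g (s.erase j) x) ∧
        (∀ x ∈ closedSimplex s, extD e x = f s x) ∧
        (s ∈ A.faces ∨ s.card ≤ k + 1 → ∀ x ∈ closedSimplex s, e x = 0) ∧
        ∀ M : ℝ, (∀ x ∈ closedSimplex s, ‖f s x‖ ≤ M) →
          (∀ j ∈ s, ∀ x ∈ closedSimplex (s.erase j), ‖g (s.erase j) x‖ ≤ M) →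
          ∀ x ∈ closedSimplex s, ‖e x‖ ≤ C * M := by
  have hface : ∀ (t : Finset V), t ⊆ s → ∀ x ∈ closedSimplex t, t ∈ X.faces := fun t ht x hx =>
    (X.isRelLowerSet_faces hs).2 ht (nonempty_of_mem_closedSimplex hx)
  have hcard : ∀ j ∈ s, (s.erase j).card = m := fun j hj => by
    rw [Finset.card_erase_of_mem hj, hm, Nat.add_sub_cancel]
  by_cases hA : s ∈ A.faces ∨ s.card ≤ k + 1
  · refine ⟨0, le_rfl, fun f hf g hd _ hg => ⟨0, IsSmooth.zero, fun j hj x hx => ?_,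
      fun x hx => ?_, fun _ _ _ => rfl, fun M _ _ x _ => ?_⟩⟩
    · rw [hg.vanish _ (hface _ (Finset.erase_subset j s) x hx) (hcard j hj).le ?_ x hx]
      · exact faceRes_apply_eq_zero _ rfl
      · refine hA.imp (fun h => (A.isRelLowerSet_faces h).2 (Finset.erase_subset j s)
          (nonempty_of_mem_closedSimplex hx)) fun h => ?_
        have := hcard j hj
        omega
    · rw [extD_zero]
      rcases hA with hA | hA
      · exact (hf.2.2 s hA x hx).symm
      · exact (eq_zero_of_card_le (f s) hx hA).symm
    · rw [zero_mul]
      exact (norm_zero (E := simplexDir s [⋀^Fin k]→L[ℝ] ℝ)).le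
  · obtain ⟨C, hC, hext⟩ := exists_primitive_extending (k := k) hm (by
      have := not_or.1 hA
      omega)
    refine ⟨C, hC, fun f hf g hd hint hg => ?_⟩
    have hX : ∀ j ∈ s, s.erase j ∈ X.faces := fun j hj => by
      refine (X.isRelLowerSet_faces hs).2 (Finset.erase_subset j s) (Finset.card_pos.1 ?_)
      have := hcard j hj
      have := not_or.1 hA
      omega
    obtain ⟨e, he, heb, hed, heM⟩ := hext (f s) (fun j => g (s.erase j)) (hf.1 s hs) hd
      ⟨fun j hj => hg.smooth _ (hX j hj) (hcard j hj).le, fun i hi j hj t hti htj x hx => by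
        rw [hg.compatible _ (hX i hi) (hcard i hi).le t hti x hx,
          hg.compatible _ (hX j hj) (hcard j hj).le t htj x hx]⟩
      (fun j hj x hx => by
        rw [hg.primitive _ (hX j hj) (hcard j hj).le x hx, hf.2.1 s hs _ _ x hx])
      (fun h => by
        rw [hint h]
        refine (Finset.sum_eq_zero fun i _ => ?_).symm
        have hi := s.orderEmbOfFin_mem h i
        rw [simplexIntegral_eq_zero _ (hg.vanish _ (hX _ hi) (hcard _ hi).le
          (Or.inr (card_erase_orderEmbOfFin h i).le)), mul_zero])
    exact ⟨e, he, heb, hed, fun h => absurd h hA, heM⟩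

/-- Simplices with `m + 1` vertices meet only along faces already treated, so the extensions over
them can be chosen independently. -/
theorem exists_skeletalPrimitive (X A : PreAbstractSimplicialComplex V) (k m : ℕ) :
    ∃ C : ℝ, 0 ≤ C ∧ ∀ f ∈ relForms X A (k + 1),
      (∀ s ∈ X.faces, ∀ x ∈ closedSimplex s, extD (f s) x = 0) →
      (∀ s ∈ X.faces, ∀ h : s.card = k + 2, simplexIntegral s h (f s) = 0) →
      ∃ g : ∀ s : Finset V, LocalForm s k, IsSkeletalPrimitive X A m f g ∧
        ∀ M : ℝ, 0 ≤ M → (∀ s ∈ X.faces, ∀ x ∈ closedSimplex s, ‖f s x‖ ≤ M) →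
          ∀ s ∈ X.faces, s.card ≤ m → ∀ x ∈ closedSimplex s, ‖g s x‖ ≤ C * M := by
  induction m with
  | zero =>
    have hcard : ∀ s ∈ X.faces, ¬ s.card ≤ 0 := fun s hs h =>
      absurd (Finset.card_pos.2 (X.isRelLowerSet_faces hs).1) (by omega)
    exact ⟨0, le_rfl, fun f _ _ _ => ⟨0, ⟨fun s hs h => absurd h (hcard s hs),
      fun s hs h => absurd h (hcard s hs), fun s hs h => absurd h (hcard s hs),
      fun s hs h => absurd h (hcard s hs)⟩, fun M _ _ s hs h => absurd h (hcard s hs)⟩⟩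
  | succ m ih =>
    obtain ⟨C₀, hC₀, hprim⟩ := ih
    have h1 : ∀ s : Finset V, ∃ C : ℝ, 0 ≤ C ∧ ∀ (hs : s ∈ X.faces) (hm : s.card = m + 1),
        ∀ f ∈ relForms X A (k + 1), ∀ g : ∀ s : Finset V, LocalForm s k,
        (∀ x ∈ closedSimplex s, extD (f s) x = 0) →
        (∀ h : s.card = k + 2, simplexIntegral s h (f s) = 0) →
        IsSkeletalPrimitive X A m f g →
        ∃ e : LocalForm s k, IsSmooth e ∧
          (∀ j ∈ s, ∀ x ∈ closedSimplex (s.erase j),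
            faceRes (Finset.erase_subset j s) e x = g (s.erase j) x) ∧
          (∀ x ∈ closedSimplex s, extD e x = f s x) ∧
          (s ∈ A.faces ∨ s.card ≤ k + 1 → ∀ x ∈ closedSimplex s, e x = 0) ∧
          ∀ M : ℝ, (∀ x ∈ closedSimplex s, ‖f s x‖ ≤ M) →
            (∀ j ∈ s, ∀ x ∈ closedSimplex (s.erase j), ‖g (s.erase j) x‖ ≤ M) →
            ∀ x ∈ closedSimplex s, ‖e x‖ ≤ C * M := by
      intro s
      by_cases h : s ∈ X.faces ∧ s.card = m + 1
      · obtain ⟨C, hC, hb⟩ := exists_primitive_on_simplex (k := k) X A h.1 h.2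
        exact ⟨C, hC, fun _ _ => hb⟩
      · exact ⟨0, le_rfl, fun hs hm => absurd ⟨hs, hm⟩ h⟩
    choose C hC hext using h1
    have hCs : ∀ s, C s ≤ ∑ t, C t := fun s =>
      Finset.single_le_sum (fun t _ => hC t) (Finset.mem_univ s)
    have hC' : 0 ≤ ∑ t, C t := Finset.sum_nonneg fun t _ => hC t
    -- Form and boundary data on a new simplex are both bounded by `(1 + C₀) * M`; the sum over all
    -- `t` dominates every local constant.
    refine ⟨C₀ + (∑ t, C t) * (1 + C₀), by positivity, fun f hf hd hint => ?_⟩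
    obtain ⟨g, hg, hgM⟩ := hprim f hf hd hint
    have h2 := fun (s : Finset V) (h : s ∈ X.faces ∧ s.card = m + 1) =>
      hext s h.1 h.2 f hf g (hd s h.1) (hint s h.1) hg
    choose e he heb hed heA heM using h2
    classical
    let g' : ∀ s : Finset V, LocalForm s k := fun s =>
      if h : s ∈ X.faces ∧ s.card = m + 1 then e s h else g s
    have hnew : ∀ s (h : s ∈ X.faces ∧ s.card = m + 1), g' s = e s h := fun s h => dif_pos h
    have hold : ∀ s, s.card ≤ m → g' s = g s := fun s h =>
      dif_neg fun h' => by omega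
    have hcases : ∀ s ∈ X.faces, s.card ≤ m + 1 → s.card ≤ m ∨ (s ∈ X.faces ∧ s.card = m + 1) :=
      fun s hs h => (Nat.le_or_eq_of_le_succ h).imp id fun h => ⟨hs, h⟩
    refine ⟨g', ⟨fun s hs h => ?_, fun s hs h t hts x hx => ?_, fun s hs h => ?_,
      fun s hs h => ?_⟩, fun M hM0 hM s hs h x hx => ?_⟩
    · rcases hcases s hs h with h | h
      · rw [hold s h]; exact hg.smooth s hs h
      · rw [hnew s h]; exact he s h
    · rcases hcases s hs h with h | h
      · rw [hold s h, hold t ((Finset.card_le_card hts).trans h)]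
        exact hg.compatible s hs h t hts x hx
      · rcases hts.eq_or_ssubset with rfl | hlt
        · rfl
        · obtain ⟨j, hj, hjt⟩ := Finset.exists_of_ssubset hlt
          have htj : t ⊆ s.erase j := fun i hi =>
            Finset.mem_erase.2 ⟨fun hij => hjt (hij ▸ hi), hts hi⟩
          have hcj : (s.erase j).card = m := by
            rw [Finset.card_erase_of_mem hj, h.2, Nat.add_sub_cancel]
          have hXj : s.erase j ∈ X.faces := (X.isRelLowerSet_faces hs).2 (Finset.erase_subset j s)
            ((nonempty_of_mem_closedSimplex hx).mono htj)
          rw [hnew s h, hold t ((Finset.card_le_card htj).trans hcj.le),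
            ← hg.compatible _ hXj hcj.le t htj x hx]
          exact faceRes_congr htj (heb s h j hj x (closedSimplex_mono htj hx))
    · rcases hcases s hs h with h | h
      · rw [hold s h]; exact hg.primitive s hs h
      · rw [hnew s h]; exact hed s h
    · rcases hcases s hs h with h | h
      · rw [hold s h]; exact hg.vanish s hs h
      · rw [hnew s h]; exact heA s h
    · have hM1 : 0 ≤ C₀ * M := mul_nonneg hC₀ hM0
      rcases hcases s hs h with h | h
      · rw [hold s h]
        refine (hgM M hM0 hM s hs h x hx).trans (mul_le_mul_of_nonneg_right ?_ hM0)
        exact le_add_of_nonneg_right (by positivity)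
      · rw [hnew s h]
        have h3 := heM s h ((1 + C₀) * M) (fun y hy => (hM s hs y hy).trans (by linarith))
          (fun j hj y hy => by
            have hcj : (s.erase j).card = m := by
              rw [Finset.card_erase_of_mem hj, h.2, Nat.add_sub_cancel]
            have hXj := (X.isRelLowerSet_faces hs).2 (Finset.erase_subset j s)
              (nonempty_of_mem_closedSimplex hy)
            exact (hgM M hM0 hM _ hXj hcj.le y hy).trans (by linarith)) x hx
        refine h3.trans ?_
        rw [← mul_assoc]
        refine mul_le_mul_of_nonneg_right ?_ hM0
        have := mul_le_mul_of_nonneg_right (hCs s) (by positivity : 0 ≤ 1 + C₀)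
        linarith

/-- The given `f` is a primitive without control. A bounded `c` with the same periods makes `d(f -
c)` period-free, and its skeletal primitive plus `c` replaces `f`. -/
theorem exists_bounded_relative_primitive (hAX : A ≤ X) (k : ℕ) :
    ∃ C : ℝ, 0 ≤ C ∧ ∀ f : relForms X A k, ∃ g : relForms X A k,
      (∀ s ∈ X.faces, ∀ x ∈ closedSimplex s, extD (g.1 s) x = extD (f.1 s) x) ∧
      ∀ M : ℝ, 0 ≤ M → (∀ s ∈ X.faces, ∀ x ∈ closedSimplex s, ‖extD (f.1 s) x‖ ≤ M) →
        ∀ s ∈ X.faces, ∀ x ∈ closedSimplex s, ‖g.1 s x‖ ≤ C * M := by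
  obtain ⟨C₁, hC₁, hcorr⟩ := exists_bounded_period_correction X A k
  -- No simplex has more vertices than `V`, so this stage covers all of `X`.
  obtain ⟨C₂, hC₂, hprim⟩ := exists_skeletalPrimitive X A k (Fintype.card V)
  refine ⟨C₁ + C₂ * (1 + C₁), by positivity, fun f => ?_⟩
  obtain ⟨c, hc, hcM⟩ := hcorr f
  have hmem : (fun s => extD ((f - c).1 s)) ∈ relForms X A (k + 1) := extD_mem_relForms (f - c).2
  have hsub : ∀ s ∈ X.faces, ∀ x ∈ closedSimplex s,
      extD ((f - c).1 s) x = extD (f.1 s) x - extD (c.1 s) x := fun s hs x hx =>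
    extD_sub (f.2.1 s hs) (c.2.1 s hs) hx
  obtain ⟨g, hg, hgM⟩ := hprim _ hmem
    (fun s hs x hx => extD_extD ((f - c).2.1 s hs) hx)
    (fun s hs h => by
      have h0 : periods X A k (f - c) = periods X A k f - periods X A k c :=
        LinearMap.map_sub (M := relForms X A k) (M₂ := Finset V → ℝ) _ f c
      rw [← periods_apply (f - c) hs h, h0, hc, sub_self, Pi.zero_apply])
  have hcard : ∀ s : Finset V, s.card ≤ Fintype.card V := Finset.card_le_univ
  have hgmem : g ∈ relForms X A k := by
    exact ⟨fun s hs => hg.smooth s hs (hcard s), fun s hs => hg.compatible s hs (hcard s),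
      fun s hs => hg.vanish s (hAX hs) (hcard s) (Or.inl hs)⟩
  refine ⟨⟨g, hgmem⟩ + c, fun s hs x hx => ?_, fun M hM0 hM s hs x hx => ?_⟩
  · refine (extD_add (hg.smooth s hs (hcard s)) (c.2.1 s hs) hx).trans ?_
    rw [hg.primitive s hs (hcard s) x hx, hsub s hs x hx, sub_add_cancel]
  · have h1 := hgM ((1 + C₁) * M) (by positivity) (fun t ht y hy => by
      rw [hsub t ht y hy]
      refine (norm_sub_le (extD (f.1 t) y) _).trans
        ((add_le_add (hM t ht y hy) (hcM M hM0 hM t ht y hy).2).trans (le_of_eq (by ring))))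
      s hs (hcard s) x hx
    refine (norm_add_le (g s x) _).trans ((add_le_add h1 (hcM M hM0 hM s hs x hx).1).trans
      (le_of_eq (by ring)))

theorem exists_bounded_primitive_of_exact (hAX : A ≤ X) (k : ℕ) :
    ∃ C : ℝ≥0, ∀ η : SimplexwiseForm X (k + 1),
      (∃ b : SimplexwiseForm X k, (b.restrict hAX).IsZero ∧ b.IsPrimitiveOf η) →
      ∃ a : SimplexwiseForm X k, (a.restrict hAX).IsZero ∧ a.IsPrimitiveOf η ∧
        a.supNorm ≤ C * η.supNorm := by
  obtain ⟨C, hC, hprim⟩ := exists_bounded_relative_primitive hAX k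
  refine ⟨C.toNNReal + 1, fun η => ?_⟩
  rintro ⟨b, hb, hbη⟩
  rw [SimplexwiseForm.isPrimitiveOf_iff] at hbη
  obtain ⟨a, ha, haM⟩ := hprim ⟨b.toFun, b.toFun_mem_relForms hb⟩
  refine ⟨SimplexwiseForm.ofMem a.1 a.2, a.2.2.2, SimplexwiseForm.isPrimitiveOf_iff.2
    fun s hs x hx => (ha s hs x hx).trans (hbη s hs x hx), SimplexwiseForm.supNorm_le _ hC
    fun hN => haM _ ENNReal.toReal_nonneg fun s hs x hx => ?_⟩
  rw [hbη s hs x hx]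
  exact η.norm_le_toReal hN le_rfl hs hx

end Pairs

end SimplicialForms

end

theorem mainTheorem9 :
    -- first quantitative Poincaré lemma, for forms of degree `k + 1` with `0 < k + 1 ≤ n`
    (∀ n k : ℕ, k + 1 ≤ n → ∃ C : ℝ≥0, ∀ ω : SimplexwiseForm (stdComplex n) (k + 1),
      ω.IsClosedForm → (ω.restrict (bdryComplex_le n)).IsZero →
      (∀ h : k + 1 = n, stdIntegral ω h = 0) →
      ∃ α : SimplexwiseForm (stdComplex n) k,
        (α.restrict (bdryComplex_le n)).IsZero ∧ α.IsPrimitiveOf ω ∧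
        α.supNorm ≤ C * ω.supNorm) ∧
    -- second quantitative Poincaré lemma, for forms of degree `k + 1` with `0 < k + 1 ≤ n`
    (∀ n k : ℕ, k + 1 ≤ n → ∃ C : ℝ≥0, ∀ (ω : SimplexwiseForm (stdComplex n) (k + 1))
      (αb : SimplexwiseForm (bdryComplex n) k),
      ω.IsClosedForm → αb.IsPrimitiveOf (ω.restrict (bdryComplex_le n)) →
      (∀ h : k + 1 = n, stdIntegral ω h = bdryIntegral αb h) →
      ∃ α : SimplexwiseForm (stdComplex n) k,
        (α.restrict (bdryComplex_le n)).Agrees αb ∧ α.IsPrimitiveOf ω ∧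
        α.supNorm ≤ C * (ω.supNorm + αb.supNorm)) ∧
    -- bounded relative primitives on a finite simplicial pair
    (∀ (V : Type*) [Fintype V] [DecidableEq V] (X A : PreAbstractSimplicialComplex V)
      (hAX : A ≤ X) (k : ℕ), ∃ C : ℝ≥0, ∀ ω : SimplexwiseForm X (k + 1),
      (∃ β : SimplexwiseForm X k, (β.restrict hAX).IsZero ∧ β.IsPrimitiveOf ω) →
      ∃ α : SimplexwiseForm X k, (α.restrict hAX).IsZero ∧ α.IsPrimitiveOf ω ∧
        α.supNorm ≤ C * ω.supNorm) := by
  refine ⟨exists_primitive_vanishing_on_bdryComplex, exists_primitive_extending_stdComplex, ?_⟩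
  intro V _ inst X A hAX k
  -- An arbitrary order of the vertices serves only to orient the simplices inside the proof.
  let L : LinearOrder V := LinearOrder.lift' (Fintype.equivFin V) (Fintype.equivFin V).injective
  obtain rfl : inst = L.toDecidableEq := Subsingleton.elim _ _
  exact exists_bounded_primitive_of_exact hAX k
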